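/- Theorem 2.1. Let $\mathbb{K}$ be a field of characteristic $0$. For a left ideal $I$ of a ring $R$ and a central element $q\in R$ write $I:q=\{r\in R\mid rq\in I\}$ and $I:q^\infty=\bigcup_{m\ge 0}(I:q^m)$. (A) Let $R$ be a $\mathbb{K}$-algebra whose center contains (a copy of) the polynomial ring $\mathbb{K}[s]$, let $q(s)\in\mathbb{K}[s]$, and let $I$ be a left ideal of $R$ with $I\cap\mathbb{K}[s]\neq 0$. Then 1. $(I+R\langle q(s)\rangle)\cap\mathbb{K}[s]=I\cap\mathbb{K}[s]+\mathbb{K}[s]\langle q(s)\rangle$; 2. $(I:q(s))\cap\mathbb{K}[s]=(I\cap\mathbb{K}[s]):q(s)$; 3. $(I:q(s)^\infty)\cap\mathbb{K}[s]=(I\cap\mathbb{K}[s]):q(s)^\infty$. (B) Let $n\ge 0$, let $R_n=\mathbb{K}[x_1,\dots,x_n]$, let $D_n$ be the $n$-th Weyl algebra, i.e. the associative $\mathbb{K}$-algebra generated by $x_i,\partial_i$ $(1\le i\le n)$ with the relations $\partial_i x_j=x_j\partial_i+\delta_{ij}$, $x_jx_i=x_ix_j$, $\partial_j\partial_i=\partial_i\partial_j$,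 and let $D_n[s]=D_n\otimes_{\mathbb{K}}\mathbb{K}[s]$. Let $0\neq f\in R_n$, and let $M=R_n[s,\frac1f]\cdot f^s$ be the free $R_n[s,\frac1f]$-module of rank one on the symbol $f^s$, with the left $D_n[s]$-module structure in which $x_i$ and $s$ act by multiplication and $$\partial_i(g\cdot f^s)=\Big(\frac{\partial g}{\partial x_i}+s\,g\,\frac{\partial f}{\partial x_i}\frac1f\Big)\cdot f^s .$$ There is exactly one monic polynomial $b_f(s)\in\mathbb{K}[s]$ of minimal degree among the monic polynomials $b(s)\in\mathbb{K}[s]$ for which some $P(s)\in D_n[s]$ satisfies $P(s)f\cdot f^s=b(s)\cdot f^s$ in $M$ (the Bernstein-Sato polynomial of $f$). Let $\operatorname{ann}_{D_n[s]}(f^s)=\{P\in D_n[s]\mid P\cdot f^s=0\}$. For every $q(s)\in\mathbb{K}[s]$ one has - $[\operatorname{ann}_{D_n[s]}(f^s)+D_n[s]\langle f,q(s)\rangle]\cap\mathbb{K}[s]=\langle b_f(s),q(s)\rangle=\langle\gcd(b_f(s),q(s))\rangle$; - $[(\operatorname{ann}_{D_n[s]}(f^s)+D_n[s]\langle f\rangle):q(s)]\cap\mathbb{K}[s]=\langle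 b_f(s)\rangle:q(s)=\big\langle \frac{b_f(s)}{\gcd(b_f(s),q(s))}\big\rangle$; - $[(\operatorname{ann}_{D_n[s]}(f^s)+D_n[s]\langle f\rangle):q(s)^\infty]\cap\mathbb{K}[s]=\langle b_f(s)\rangle:q(s)^\infty$. -/

import Mathlib

open Polynomial

noncomputable section

/-! ### Saturation of a left ideal -/

/-- The saturation `I : q^∞ = ⋃ₘ (I : qᵐ)` of a left ideal `I`, where `I : qᵐ = {r | r * qᵐ ∈ I}`
is the quotient ideal.  For central `q` these quotients form an increasing chain, so that their
supremum is their union; see `mem_saturation`. -/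
def saturation {R : Type*} [Ring R] (I : Ideal R) (q : R) : Ideal R :=
  ⨆ m : ℕ, I.colon {q ^ m}

theorem mem_saturation {R : Type*} [Ring R] (I : Ideal R) (q : R) (hq : ∀ r, Commute q r) (r : R) :
    r ∈ saturation I q ↔ ∃ m : ℕ, r * q ^ m ∈ I := by
  have hmono : Monotone fun m : ℕ => (I.colon {q ^ m} : Ideal R) := by
    refine monotone_nat_of_le_succ fun m x hx => ?_
    rw [Submodule.mem_colon_singleton, smul_eq_mul] at hx ⊢
    have : x * q ^ (m + 1) = q * (x * q ^ m) := by
      rw [pow_succ, ← mul_assoc, ← (hq (x * q ^ m)).eq]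
    rw [this]
    exact I.mul_mem_left _ hx
  rw [saturation, Submodule.mem_iSup_of_directed _ hmono.directed_le]
  simp [Submodule.mem_colon_singleton]

/-! ### The Weyl algebra `D_n` and `D_n[s]` -/

/-- The defining relations of the `n`-th Weyl algebra; `Sum.inl i` is the letter `x_i` and
`Sum.inr i` is the letter `∂_i`. -/
inductive WeylRel (K : Type*) [Field K] (n : ℕ) :
    FreeAlgebra K (Fin n ⊕ Fin n) → FreeAlgebra K (Fin n ⊕ Fin n) → Prop
  | x_comm (i j : Fin n) : WeylRel K n
      (FreeAlgebra.ι K (Sum.inl j) * FreeAlgebra.ι K (Sum.inl i))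
      (FreeAlgebra.ι K (Sum.inl i) * FreeAlgebra.ι K (Sum.inl j))
  | d_comm (i j : Fin n) : WeylRel K n
      (FreeAlgebra.ι K (Sum.inr j) * FreeAlgebra.ι K (Sum.inr i))
      (FreeAlgebra.ι K (Sum.inr i) * FreeAlgebra.ι K (Sum.inr j))
  | d_x (i j : Fin n) : WeylRel K n
      (FreeAlgebra.ι K (Sum.inr i) * FreeAlgebra.ι K (Sum.inl j))
      (FreeAlgebra.ι K (Sum.inl j) * FreeAlgebra.ι K (Sum.inr i) + if i = j then 1 else 0)

/-- The `n`-th Weyl algebra `D_n` over `K`. -/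
def WeylAlgebra (K : Type*) [Field K] (n : ℕ) : Type _ := RingQuot (WeylRel K n)

instance (K : Type*) [Field K] (n : ℕ) : Ring (WeylAlgebra K n) :=
  inferInstanceAs (Ring (RingQuot (WeylRel K n)))

instance (K : Type*) [Field K] (n : ℕ) : Algebra K (WeylAlgebra K n) :=
  inferInstanceAs (Algebra K (RingQuot (WeylRel K n)))

namespace WeylAlgebra

/-- The generator `x_i` of `D_n`. -/
def x (K : Type*) [Field K] {n : ℕ} (i : Fin n) : WeylAlgebra K n :=
  RingQuot.mkAlgHom K (WeylRel K n) (FreeAlgebra.ι K (Sum.inl i))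

/-- The generator `∂_i` of `D_n`. -/
def d (K : Type*) [Field K] {n : ℕ} (i : Fin n) : WeylAlgebra K n :=
  RingQuot.mkAlgHom K (WeylRel K n) (FreeAlgebra.ι K (Sum.inr i))

theorem x_mul_x (K : Type*) [Field K] {n : ℕ} (i j : Fin n) : x K j * x K i = x K i * x K j := by
  have h := RingQuot.mkAlgHom_rel K (WeylRel.x_comm (K := K) i j)
  rw [map_mul, map_mul] at h
  exact h

open scoped IsMulCommutative in
/-- The canonical map `K[x_1, …, x_n] → D_n`, `x_i ↦ x_i`. -/
def ofPoly (K : Type*) [Field K] (n : ℕ) : MvPolynomial (Fin n) K →ₐ[K] WeylAlgebra K n :=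
  have : IsMulCommutative (Algebra.adjoin K (Set.range (x K (n := n)))) :=
    Algebra.isMulCommutative_adjoin K (by
      rintro _ ⟨i, rfl⟩ _ ⟨j, rfl⟩
      exact x_mul_x K j i)
  (Algebra.adjoin K (Set.range (x K (n := n)))).val.comp
    (MvPolynomial.aeval fun i => ⟨x K i, Algebra.subset_adjoin ⟨i, rfl⟩⟩)

theorem ofPoly_X (K : Type*) [Field K] (n : ℕ) (i : Fin n) :
    ofPoly K n (MvPolynomial.X i) = x K i := by
  simp [ofPoly]

/-- The inclusion `K[s] → D_n[s]`, where `D_n[s]` is the ring of polynomials over `D_n` in a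
(central) variable `s`. -/
def ofS (K : Type*) [Field K] (n : ℕ) : K[X] →ₐ[K] (WeylAlgebra K n)[X] :=
  Polynomial.mapAlgHom (Algebra.ofId K (WeylAlgebra K n))

end WeylAlgebra

/-! ### Extending a derivation to a localization -/

section LocDeriv

variable {A S : Type*} [CommRing A] [CommRing S] [Algebra A S]

/-- The ring homomorphism `g ↦ g + (d g) ε` to the dual numbers over `S[1/f]`,
extended from `S` to `S[1/f]`. -/
def dualLift (d : Derivation A S S) (f : S) :
    Localization.Away f →+* TrivSqZeroExt (Localization.Away f) (Localization.Away f) :=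
  IsLocalization.Away.lift (S := Localization.Away f) f
    (g := { toFun := fun g => TrivSqZeroExt.inl (algebraMap S (Localization.Away f) g) +
              TrivSqZeroExt.inr (algebraMap S (Localization.Away f) (d g))
            map_one' := by simp
            map_zero' := by simp
            map_add' := fun a b => by
              rw [map_add, map_add, map_add, TrivSqZeroExt.inl_add, TrivSqZeroExt.inr_add]
              abel
            map_mul' := fun a b => by
              ext
              · simp
              · simp only [TrivSqZeroExt.snd_add, TrivSqZeroExt.snd_mul, TrivSqZeroExt.snd_inl,
                  TrivSqZeroExt.snd_inr, TrivSqZeroExt.fst_add, TrivSqZeroExt.fst_inl,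
                  TrivSqZeroExt.fst_inr, Derivation.leibniz, map_add, map_mul, smul_eq_mul,
                  MulOpposite.smul_eq_mul_unop, MulOpposite.unop_op, zero_add, add_zero]
                ring })
    (by
      rw [TrivSqZeroExt.isUnit_iff_isUnit_fst]
      simpa using IsLocalization.Away.algebraMap_isUnit (S := Localization.Away f) f)

theorem dualLift_algebraMap (d : Derivation A S S) (f g : S) :
    dualLift d f (algebraMap S _ g) =
      TrivSqZeroExt.inl (algebraMap S (Localization.Away f) g) +
        TrivSqZeroExt.inr (algebraMap S (Localization.Away f) (d g)) := by
  simp [dualLift, IsLocalization.Away.lift_eq]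

theorem fst_dualLift (d : Derivation A S S) (f : S) (u : Localization.Away f) :
    (dualLift d f u).fst = u := by
  have : (TrivSqZeroExt.fstHom S (Localization.Away f) (Localization.Away f)).toRingHom.comp
      (dualLift d f) = RingHom.id _ := by
    refine IsLocalization.ringHom_ext (Submonoid.powers f) ?_
    ext g
    simp [dualLift_algebraMap]
  exact congrArg (fun h : _ →+* _ => h u) this

/-- The unique extension of a derivation `d` of `S` to the localization `S[1/f]`. -/
def locDeriv (d : Derivation A S S) (f : S) :
    Derivation A (Localization.Away f) (Localization.Away f) :=
  Derivation.mk'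
    { toFun := fun u => (dualLift d f u).snd
      map_add' := fun u v => by simp
      map_smul' := fun a u => by
        have h : dualLift d f (algebraMap A (Localization.Away f) a) =
            TrivSqZeroExt.inl (algebraMap A (Localization.Away f) a) := by
          rw [IsScalarTower.algebraMap_apply A S (Localization.Away f), dualLift_algebraMap]
          simp
        simp [Algebra.smul_def, h] }
    (fun u v => by simp [fst_dualLift, mul_comm])

/-- `locDeriv d f` extends `d`. -/
theorem locDeriv_algebraMap (d : Derivation A S S) (f g : S) :
    locDeriv d f (algebraMap S _ g) = algebraMap S (Localization.Away f) (d g) := by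
  change (dualLift d f (algebraMap S _ g)).snd = _
  rw [dualLift_algebraMap, TrivSqZeroExt.snd_add, TrivSqZeroExt.snd_inl, TrivSqZeroExt.snd_inr,
    zero_add]

/-- A derivation of `S[1/f]` is determined by its restriction to `S`. -/
theorem locDeriv_ext (f : S) (D : Derivation A (Localization.Away f) (Localization.Away f))
    (h : ∀ g : S, D (algebraMap S _ g) = 0) (u : Localization.Away f) : D u = 0 := by
  obtain ⟨⟨a, t⟩, ht⟩ := IsLocalization.surj (Submonoid.powers f) u
  have h1 := congrArg D ht
  simp only [Derivation.leibniz, h, smul_eq_mul, mul_zero, zero_add] at h1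
  exact (IsLocalization.map_units (Localization.Away f) t).mul_right_eq_zero.mp h1

end LocDeriv

/-! ### The module `R_n[s, 1/f] · f^s` -/

section FsModule

variable {K : Type*} [Field K] {n : ℕ}

/-- A polynomial `g ∈ R_n = K[x_1, …, x_n]`, seen in `R_n[s] = K[s][x_1, …, x_n]`. -/
def toRs (g : MvPolynomial (Fin n) K) : MvPolynomial (Fin n) K[X] :=
  MvPolynomial.map Polynomial.C g

/-- The ring `R_n[s, 1/f]`. -/
abbrev RsInv (f : MvPolynomial (Fin n) K) : Type _ := Localization.Away (toRs f)

/-- The derivation `∂/∂x_i` of `R_n[s, 1/f]`. -/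
def partialRs (f : MvPolynomial (Fin n) K) (i : Fin n) : Derivation K[X] (RsInv f) (RsInv f) :=
  locDeriv (MvPolynomial.pderiv i) (toRs f)

/-- The element `s * (∂f/∂x_i) * (1/f)` of `R_n[s, 1/f]`. -/
def fsLogDeriv (f : MvPolynomial (Fin n) K) (i : Fin n) : RsInv f :=
  algebraMap K[X] (RsInv f) X *
    algebraMap (MvPolynomial (Fin n) K[X]) (RsInv f) (toRs (MvPolynomial.pderiv i f)) *
      IsLocalization.Away.invSelf (toRs f)

/-- The action of the letters `x_i`, `∂_i` on `g ∈ R_n[s, 1/f]`, which stands for `g · f^s`: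
`x_i` multiplies by `x_i`, and `∂_i` maps `g` to `∂g/∂x_i + s g (∂f/∂x_i) (1/f)`. -/
def letterAct (f : MvPolynomial (Fin n) K) : Fin n ⊕ Fin n → Module.End K[X] (RsInv f)
  | Sum.inl i => LinearMap.mulLeft K[X] (algebraMap (MvPolynomial (Fin n) K[X]) (RsInv f) (MvPolynomial.X i))
  | Sum.inr i => (partialRs f i).toLinearMap + LinearMap.mulLeft K[X] (fsLogDeriv f i)

theorem partialRs_algebraMap (f : MvPolynomial (Fin n) K) (i : Fin n)
    (g : MvPolynomial (Fin n) K[X]) :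
    partialRs f i (algebraMap _ (RsInv f) g) = algebraMap _ (RsInv f) (MvPolynomial.pderiv i g) :=
  locDeriv_algebraMap _ _ _

theorem pderiv_comm {R : Type*} [CommRing R] (i j : Fin n) (g : MvPolynomial (Fin n) R) :
    MvPolynomial.pderiv i (MvPolynomial.pderiv j g) =
      MvPolynomial.pderiv j (MvPolynomial.pderiv i g) := by
  have : ⁅MvPolynomial.pderiv (R := R) i, MvPolynomial.pderiv (R := R) j⁆ = 0 := by
    refine MvPolynomial.derivation_ext fun k => ?_
    simp only [Derivation.commutator_apply, MvPolynomial.pderiv_X, Pi.single_apply,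
      Derivation.zero_apply]
    split_ifs <;> simp
  have h := congrArg (fun D : Derivation R _ _ => D g) this
  simpa [Derivation.commutator_apply, sub_eq_zero] using h

theorem partialRs_comm (f : MvPolynomial (Fin n) K) (i j : Fin n) (u : RsInv f) :
    partialRs f i (partialRs f j u) = partialRs f j (partialRs f i u) := by
  have h := locDeriv_ext (toRs f) ⁅partialRs f i, partialRs f j⁆ (fun g => by
    simp only [Derivation.commutator_apply, partialRs_algebraMap, pderiv_comm i j, sub_self]) u
  simpa [Derivation.commutator_apply, sub_eq_zero] using h

theorem pderiv_toRs (i : Fin n) (g : MvPolynomial (Fin n) K) :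
    MvPolynomial.pderiv i (toRs g) = toRs (MvPolynomial.pderiv i g) :=
  MvPolynomial.pderiv_map

theorem partialRs_fsLogDeriv (f : MvPolynomial (Fin n) K) (i j : Fin n) :
    partialRs f i (fsLogDeriv f j) = partialRs f j (fsLogDeriv f i) := by
  have hu : algebraMap _ (RsInv f) (toRs f) * IsLocalization.Away.invSelf (toRs f) = 1 :=
    IsLocalization.Away.mul_invSelf (toRs f)
  have hv : ∀ k, partialRs f k (IsLocalization.Away.invSelf (toRs f)) =
      - (IsLocalization.Away.invSelf (toRs f)) ^ 2 *
        algebraMap _ (RsInv f) (toRs (MvPolynomial.pderiv k f)) := by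
    intro k
    have h := congrArg (partialRs f k) hu
    simp only [Derivation.leibniz, partialRs_algebraMap, pderiv_toRs, smul_eq_mul,
      Derivation.map_one_eq_zero] at h
    linear_combination (IsLocalization.Away.invSelf (toRs f)) * h -
      (partialRs f k (IsLocalization.Away.invSelf (toRs f))) * hu
  simp only [fsLogDeriv, Derivation.leibniz, partialRs_algebraMap, pderiv_toRs, smul_eq_mul, hv,
    Derivation.map_algebraMap, pderiv_comm i j]
  ring

/-- The action of `D_n` on `R_n[s, 1/f] · f^s`. -/
def weylAct (f : MvPolynomial (Fin n) K) : WeylAlgebra K n →ₐ[K] Module.End K[X] (RsInv f) :=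
  RingQuot.liftAlgHom K ⟨FreeAlgebra.lift K (letterAct f), by
    rintro _ _ (⟨i, j⟩ | ⟨i, j⟩ | ⟨i, j⟩)
    · ext u
      simp [letterAct, mul_left_comm]
    · ext u
      simp only [map_mul, FreeAlgebra.lift_ι_apply, letterAct, Module.End.mul_apply,
        LinearMap.add_apply, LinearMap.mulLeft_apply, Derivation.coeFn_coe, map_add,
        Derivation.leibniz, smul_eq_mul, partialRs_comm f j i, partialRs_fsLogDeriv f j i]
      ring
    · ext u
      split_ifs with h
      · subst h
        simp [letterAct, partialRs_algebraMap]
        ring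
      · simp [letterAct, partialRs_algebraMap, MvPolynomial.pderiv_X_of_ne (Ne.symm h)]
        ring⟩

/-- The action of `D_n[s]` on `R_n[s, 1/f] · f^s`: here `s` acts as multiplication by `s`. -/
def weylSAct (f : MvPolynomial (Fin n) K) :
    (WeylAlgebra K n)[X] →+* Module.End K[X] (RsInv f) :=
  Polynomial.eval₂RingHom' (weylAct f : WeylAlgebra K n →+* Module.End K[X] (RsInv f))
    (algebraMap K[X] (Module.End K[X] (RsInv f)) X)
    (fun a => (Algebra.commutes (X : K[X]) (weylAct f a)).symm)

/-- The module `M = R_n[s, 1/f] · f^s`, free of rank one over `R_n[s, 1/f]` on the symbol `f^s`;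
the element `g : RsInv f` stands for `g · f^s`. -/
def FsModule (f : MvPolynomial (Fin n) K) : Type _ := RsInv f

instance (f : MvPolynomial (Fin n) K) : AddCommGroup (FsModule f) :=
  inferInstanceAs (AddCommGroup (RsInv f))

instance (f : MvPolynomial (Fin n) K) : Module (Module.End K[X] (RsInv f)) (FsModule f) :=
  inferInstanceAs (Module (Module.End K[X] (RsInv f)) (RsInv f))

/-- The structure of a left `D_n[s]`-module on `M`. -/
instance (f : MvPolynomial (Fin n) K) : Module (WeylAlgebra K n)[X] (FsModule f) :=
  Module.compHom (FsModule f) (weylSAct f)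

/-- The element `g · f^s` of `M`. -/
def FsModule.mk (f : MvPolynomial (Fin n) K) (g : RsInv f) : FsModule f := g

/-- The generator `f^s` of `M`. -/
def fs (f : MvPolynomial (Fin n) K) : FsModule f := FsModule.mk f 1

theorem d_smul (f : MvPolynomial (Fin n) K) (i : Fin n) (g : RsInv f) :
    (C (WeylAlgebra.d K i) : (WeylAlgebra K n)[X]) • FsModule.mk f g =
      FsModule.mk f (partialRs f i g + fsLogDeriv f i * g) := by
  change weylSAct f (C (WeylAlgebra.d K i)) g = _
  have : weylAct f (WeylAlgebra.d K i) = letterAct f (Sum.inr i) :=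
    (RingQuot.liftAlgHom_mkAlgHom_apply K _ _ _).trans (FreeAlgebra.lift_ι_apply _ _)
  simp [weylSAct, eval₂RingHom', this, letterAct, FsModule.mk]

theorem x_smul (f : MvPolynomial (Fin n) K) (i : Fin n) (g : RsInv f) :
    (C (WeylAlgebra.x K i) : (WeylAlgebra K n)[X]) • FsModule.mk f g =
      FsModule.mk f (algebraMap (MvPolynomial (Fin n) K[X]) (RsInv f) (MvPolynomial.X i) * g) := by
  change weylSAct f (C (WeylAlgebra.x K i)) g = _
  have : weylAct f (WeylAlgebra.x K i) = letterAct f (Sum.inl i) :=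
    (RingQuot.liftAlgHom_mkAlgHom_apply K _ _ _).trans (FreeAlgebra.lift_ι_apply _ _)
  simp [weylSAct, eval₂RingHom', this, letterAct, FsModule.mk]

theorem s_smul (f : MvPolynomial (Fin n) K) (g : RsInv f) :
    (X : (WeylAlgebra K n)[X]) • FsModule.mk f g =
      FsModule.mk f (algebraMap K[X] (RsInv f) X * g) := by
  change weylSAct f X g = _
  simp [weylSAct, eval₂RingHom', FsModule.mk, Algebra.smul_def]

/-! ### The Bernstein-Sato polynomial -/

/-- The polynomial `f ∈ R_n` as an element of `D_n[s]`. -/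
def polyInWeylS (f : MvPolynomial (Fin n) K) : (WeylAlgebra K n)[X] :=
  C (WeylAlgebra.ofPoly K n f)

/-- Bernstein's functional equation `P(s) f · f^s = b(s) · f^s` has a solution
`P(s) ∈ D_n[s]`. -/
def SolvesBernstein (f : MvPolynomial (Fin n) K) (b : K[X]) : Prop :=
  ∃ P : (WeylAlgebra K n)[X], (P * polyInWeylS f) • fs f = WeylAlgebra.ofS K n b • fs f

/-- `b` is a Bernstein-Sato polynomial of `f`: a monic polynomial of minimal degree
that satisfies Bernstein's functional equation. -/
def IsBernsteinSato (f : MvPolynomial (Fin n) K) (b : K[X]) : Prop :=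
  b.Monic ∧ SolvesBernstein f b ∧
    ∀ c : K[X], c.Monic → SolvesBernstein f c → b.natDegree ≤ c.natDegree

/-- The annihilator of `f^s` in `D_n[s]`, a left ideal. -/
def annFs (f : MvPolynomial (Fin n) K) : Ideal (WeylAlgebra K n)[X] :=
  Ideal.torsionOf (WeylAlgebra K n)[X] (FsModule f) (fs f)

theorem mem_annFs (f : MvPolynomial (Fin n) K) (P : (WeylAlgebra K n)[X]) :
    P ∈ annFs f ↔ P • fs f = 0 := Iff.rfl

end FsModule

end

/-! Part (A) rests on `K[X]` being a principal ideal domain. Let `b` generate `I ∩ K[s]` and write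
`b = g b'`, `q = g q'` with `g` the gcd. For `h ∈ I + R q` the element `b' h` lies in `I`, because
`b' q = q' b` and `q` is central; so `b = g b'` divides `b' h`, and `g` divides `h`. The two
quotient statements only compare membership conditions.

Part (B) applies (A) to `I = ann(f^s) + ⟨f⟩`. The polynomials in `I ∩ K[s]` are exactly the
solutions of Bernstein's functional equation (`mem_comap_annFs_sup_span`), so `b_f` generates the
intersection. The substance is Bernstein's theorem that a nonzero solution exists
(`exists_solvesBernstein`).

Its proof is a growth argument. The pole filtration of `R_n[s, 1/f]` has `K[s]`-ranks bounded by a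
constant times `k ^ n`, while Bernstein's inequality (`pow_le_finrank`) makes every nonzero
torsion-free subquotient grow at least like `k ^ n`, with a constant depending on `n` only. Hence
the `K[s]`-saturations of the modules `D_n[s] f^k · f^s` cannot decrease strictly forever, and `a(s)
f^k · f^s = P(s) f^(k+1) · f^s` for some `k` and some `a ≠ 0`. The substitution `s ↦ s - k` turns
this into Bernstein's equation. Saturated submodules and ranks over `K[s]` play the role of vector
spaces and dimensions over `K(s)`. -/

noncomputable section

/-! ### Left ideals and a central polynomial ring -/

section CentralPolynomials

variable {K : Type*} [Field K] {R : Type*} [Ring R] [Algebra K R] {φ : K[X] →ₐ[K] R}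

theorem comap_sup_span_singleton (hφ : φ.range ≤ Subalgebra.center K R) (q : K[X]) (I : Ideal R)
    (hI : I.comap φ ≠ ⊥) :
    (I ⊔ Ideal.span {φ q}).comap φ = I.comap φ ⊔ Ideal.span {q} := by
  have hcomm : ∀ (a : K[X]) (r : R), r * φ a = φ a * r := fun a r =>
    Subalgebra.mem_center_iff.1 (hφ ⟨a, rfl⟩) r
  refine le_antisymm ?_ ?_
  · intro h hh
    obtain ⟨b, hb⟩ := IsPrincipalIdealRing.principal (I.comap φ)
    obtain ⟨g, hg⟩ := IsPrincipalIdealRing.principal (I.comap φ ⊔ Ideal.span {q})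
    rw [hg, Submodule.mem_span_singleton]
    have hbI : φ b ∈ I := by
      have : b ∈ I.comap φ := hb ▸ Submodule.mem_span_singleton_self b
      exact this
    obtain ⟨b', hb'⟩ : g ∣ b := by
      have : b ∈ Submodule.span K[X] {g} := hg ▸ Ideal.mem_sup_left hbI
      exact Ideal.mem_span_singleton.1 this
    obtain ⟨q', hq'⟩ : g ∣ q := by
      have : q ∈ Submodule.span K[X] {g} :=
        hg ▸ Ideal.mem_sup_right (Ideal.mem_span_singleton_self q)
      exact Ideal.mem_span_singleton.1 this
    have hb0 : b ≠ 0 := by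
      rintro rfl
      exact hI (by simpa using hb)
    rw [Ideal.mem_comap, Submodule.mem_sup] at hh
    obtain ⟨i, hi, y, hy, hiy⟩ := hh
    obtain ⟨r, rfl⟩ := Ideal.mem_span_singleton'.1 hy
    -- Multiplying by the cofactor `b'` moves `r q` into `I`, since `b' q = q' b`.
    have key : b' * h ∈ I.comap φ := by
      rw [Ideal.mem_comap, map_mul, ← hiy, mul_add]
      refine I.add_mem (I.mul_mem_left _ hi) ?_
      have : φ b' * (r * φ q) = r * φ q' * φ b := by
        rw [← mul_assoc, ← hcomm b' r, mul_assoc, mul_assoc, ← map_mul, ← map_mul, hb', hq']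
        congr 2
        ring
      rw [this]
      exact I.mul_mem_left _ hbI
    rw [hb] at key
    obtain ⟨c, hc⟩ := Ideal.mem_span_singleton.1 key
    have hb'0 : b' ≠ 0 := by
      rintro rfl
      exact hb0 (by simp [hb'])
    refine ⟨c, ?_⟩
    -- Cancelling `b'` requires `b ≠ 0`: this is the use of `I ∩ K[s] ≠ 0`.
    apply mul_left_cancel₀ hb'0
    rw [hc, hb', smul_eq_mul]
    ring
  · refine sup_le (Ideal.comap_mono le_sup_left) ?_
    rw [Ideal.span_singleton_le_iff_mem]
    exact Ideal.mem_sup_right (Ideal.mem_span_singleton_self _)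

theorem comap_colon_singleton (q : K[X]) (I : Ideal R) :
    Ideal.comap φ (I.colon {φ q}) = (I.comap φ).colon {q} := by
  ext r
  simp [Submodule.mem_colon_singleton]

theorem comap_saturation (hφ : φ.range ≤ Subalgebra.center K R) (q : K[X]) (I : Ideal R) :
    (saturation I (φ q)).comap φ = saturation (I.comap φ) q := by
  ext r
  rw [Ideal.mem_comap, mem_saturation I (φ q) (fun r =>
    (Subalgebra.mem_center_iff.1 (hφ ⟨q, rfl⟩) r).symm), mem_saturation _ q (fun r => .all _ _)]
  simp

theorem span_pair_eq_span_gcd [DecidableEq K] (b q : K[X]) :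
    Ideal.span {b, q} = Ideal.span {EuclideanDomain.gcd b q} :=
  (EuclideanDomain.span_gcd b q).symm

theorem colon_span_singleton_of_isCoprime {R : Type*} [CommRing R] [IsDomain R] {g b q : R}
    (hg : g ≠ 0) (h : IsCoprime b q) : (Ideal.span {g * b}).colon {g * q} = Ideal.span {b} := by
  ext r
  rw [Submodule.mem_colon_singleton, smul_eq_mul, Ideal.mem_span_singleton,
    Ideal.mem_span_singleton, mul_left_comm, mul_dvd_mul_iff_left hg]
  exact ⟨h.dvd_of_dvd_mul_right, fun h => h.mul_right _⟩

theorem colon_span_singleton [DecidableEq K] {b : K[X]} (hb : b ≠ 0) (q : K[X]) :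
    (Ideal.span {b}).colon {q} = Ideal.span {b / EuclideanDomain.gcd b q} := by
  have hg : EuclideanDomain.gcd b q ≠ 0 := fun h => hb (EuclideanDomain.gcd_eq_zero_iff.1 h).1
  have h1 := EuclideanDomain.mul_div_cancel' hg (EuclideanDomain.gcd_dvd_left b q)
  have h2 := EuclideanDomain.mul_div_cancel' hg (EuclideanDomain.gcd_dvd_right b q)
  have hcop : IsCoprime (b / EuclideanDomain.gcd b q) (q / EuclideanDomain.gcd b q) := by
    refine ⟨EuclideanDomain.gcdA b q, EuclideanDomain.gcdB b q, mul_left_cancel₀ hg ?_⟩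
    linear_combination (EuclideanDomain.gcdA b q) * h1 + (EuclideanDomain.gcdB b q) * h2 -
      EuclideanDomain.gcd_eq_gcd_ab b q
  simpa only [h1, h2] using colon_span_singleton_of_isCoprime hg hcop

end CentralPolynomials

/-! ### Normally ordered polynomials in operators satisfying the Weyl relations -/

section NormalOrder

variable {ι : Type*} {A : Type*} [CommRing A] {E : Type*} [Ring E] [Algebra A E]

/-- The families `x` and `d` satisfy the relations of the Weyl algebra. -/
structure IsWeylPair [DecidableEq ι] (x d : ι → E) : Prop where
  x_comm : ∀ i j, x i * x j = x j * x i
  d_comm : ∀ i j, d i * d j = d j * d i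
  d_x : ∀ i j, d i * x j = x j * d i + if i = j then 1 else 0

variable (A) in
open scoped IsMulCommutative in
-- `E` is not commutative, so evaluation passes through the commutative subalgebra generated by the
-- family.
theorem exists_algHom_of_commute (a : ι → E) (h : ∀ i j, a i * a j = a j * a i) :
    ∃ φ : MvPolynomial ι A →ₐ[A] E, ∀ i, φ (MvPolynomial.X i) = a i := by
  have : IsMulCommutative (Algebra.adjoin A (Set.range a)) :=
    Algebra.isMulCommutative_adjoin A (by
      rintro _ ⟨i, rfl⟩ _ ⟨j, rfl⟩
      exact h i j)
  exact ⟨(Algebra.adjoin A (Set.range a)).val.comp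
    (MvPolynomial.aeval fun i => ⟨a i, Algebra.subset_adjoin ⟨i, rfl⟩⟩), fun i => by simp⟩

/-- Commutation with `c` is a derivation, determined by its values on the letters. The sign `ε` is
`1` for `d` against `x j`, `-1` for `x` against `d j`, and `0` for letters of the same kind. -/
theorem algHom_mul_sub_of_commutator [DecidableEq ι] {a : ι → E} {c : E} {ε : A} {j : ι}
    {φ : MvPolynomial ι A →ₐ[A] E} (hφ : ∀ i, φ (MvPolynomial.X i) = a i)
    (hc : ∀ i, a i * c = c * a i + if i = j then algebraMap A E ε else 0)
    (p : MvPolynomial ι A) :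
    φ p * c = c * φ p + ε • φ (MvPolynomial.pderiv j p) := by
  induction p using MvPolynomial.induction_on with
  | C r => simp [← MvPolynomial.algebraMap_eq, Algebra.commutes]
  | add p q hp hq => simp only [map_add, add_mul, mul_add, hp, hq, smul_add]; abel
  | mul_X p i hp =>
    have : (MvPolynomial.pderiv j) (p * MvPolynomial.X i) =
        MvPolynomial.pderiv j p * MvPolynomial.X i + if i = j then p else 0 := by
      rw [MvPolynomial.pderiv_mul, MvPolynomial.pderiv_X, Pi.single_apply]
      split_ifs <;> simp
    rw [this, map_mul, hφ, mul_assoc, hc, mul_add, ← mul_assoc, hp, map_add, map_mul, hφ, smul_add,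
      add_mul, mul_assoc, smul_mul_assoc, add_assoc]
    congr 2
    split_ifs with h
    · rw [← Algebra.commutes, Algebra.smul_def]
    · simp

theorem tensorEquivSum_tmul (p q : MvPolynomial ι A) :
    MvPolynomial.tensorEquivSum A ι ι A (p ⊗ₜ q) =
      MvPolynomial.rename Sum.inl p * MvPolynomial.rename Sum.inr q := by
  have h1 : (MvPolynomial.tensorEquivSum A ι ι A).toAlgHom.comp
      Algebra.TensorProduct.includeLeft = MvPolynomial.rename Sum.inl := by
    ext i; simp
  have h2 : (MvPolynomial.tensorEquivSum A ι ι A).toAlgHom.comp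
      Algebra.TensorProduct.includeRight = MvPolynomial.rename Sum.inr := by
    ext i; simp
  rw [← h1, ← h2]
  simp [← map_mul]

/-- Polynomials in both alphabets form the tensor product of the two polynomial rings, so additive
statements need only be checked on products `p(x) q(d)`. -/
theorem induction_rename_mul_rename {motive : MvPolynomial (ι ⊕ ι) A → Prop}
    (mul : ∀ p q, motive (MvPolynomial.rename Sum.inl p * MvPolynomial.rename Sum.inr q))
    (add : ∀ P Q, motive P → motive Q → motive (P + Q)) (P : MvPolynomial (ι ⊕ ι) A) :
    motive P := by
  obtain ⟨t, rfl⟩ := (MvPolynomial.tensorEquivSum A ι ι A).surjective P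
  induction t using TensorProduct.induction_on with
  | zero => simpa using mul 0 0
  | tmul p q => rw [tensorEquivSum_tmul]; exact mul p q
  | add s t hs ht => rw [map_add]; exact add _ _ hs ht

theorem pderiv_rename_of_notMem_range {σ τ : Type*} {f : σ → τ} {j : τ} (hj : j ∉ Set.range f)
    (p : MvPolynomial σ A) : MvPolynomial.pderiv j (MvPolynomial.rename f p) = 0 := by
  classical
  refine MvPolynomial.pderiv_eq_zero_of_notMem_vars fun hmem => hj ?_
  obtain ⟨i, -, hi⟩ := Finset.mem_image.1 (MvPolynomial.vars_rename f p hmem)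
  exact ⟨i, hi⟩

variable [DecidableEq ι] {x d : ι → E}

namespace IsWeylPair

variable (A) in
/-- The action of polynomials in the letters `x`. -/
def xPoly (h : IsWeylPair x d) : MvPolynomial ι A →ₐ[A] E :=
  (exists_algHom_of_commute A x h.x_comm).choose

variable (A) in
/-- The action of polynomials in the letters `d`. -/
def dPoly (h : IsWeylPair x d) : MvPolynomial ι A →ₐ[A] E :=
  (exists_algHom_of_commute A d h.d_comm).choose

theorem xPoly_X (h : IsWeylPair x d) (i : ι) : h.xPoly A (MvPolynomial.X i) = x i :=
  (exists_algHom_of_commute A x h.x_comm).choose_spec i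

theorem dPoly_X (h : IsWeylPair x d) (i : ι) : h.dPoly A (MvPolynomial.X i) = d i :=
  (exists_algHom_of_commute A d h.d_comm).choose_spec i

variable (A) in
/-- The operator obtained from a polynomial in commuting letters `x` and `d` by writing each
monomial with the letters `x` on the left. -/
def normalOrder (h : IsWeylPair x d) : MvPolynomial (ι ⊕ ι) A →ₗ[A] E :=
  (LinearMap.mul' A E ∘ₗ TensorProduct.map (h.xPoly A).toLinearMap (h.dPoly A).toLinearMap) ∘ₗ
    (MvPolynomial.tensorEquivSum A ι ι A).symm.toLinearMap

theorem normalOrder_rename_mul_rename (h : IsWeylPair x d) (p q : MvPolynomial ι A) :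
    h.normalOrder A (MvPolynomial.rename Sum.inl p * MvPolynomial.rename Sum.inr q) =
      h.xPoly A p * h.dPoly A q := by
  rw [← tensorEquivSum_tmul]
  simp [normalOrder]

theorem normalOrder_C (h : IsWeylPair x d) (c : A) :
    h.normalOrder A (MvPolynomial.C c) = algebraMap A E c := by
  have := h.normalOrder_rename_mul_rename (MvPolynomial.C c) 1
  simpa [← MvPolynomial.algebraMap_eq] using this

theorem normalOrder_X_inl_mul (h : IsWeylPair x d) (i : ι) (P : MvPolynomial (ι ⊕ ι) A) :
    h.normalOrder A (MvPolynomial.X (Sum.inl i) * P) = x i * h.normalOrder A P := by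
  induction P using induction_rename_mul_rename with
  | mul p q =>
    rw [← mul_assoc, ← MvPolynomial.rename_X, ← map_mul, normalOrder_rename_mul_rename,
      normalOrder_rename_mul_rename, map_mul, xPoly_X, mul_assoc]
  | add P Q hP hQ => rw [mul_add, map_add, map_add, hP, hQ, mul_add]

theorem normalOrder_mul_X_inr (h : IsWeylPair x d) (i : ι) (P : MvPolynomial (ι ⊕ ι) A) :
    h.normalOrder A (P * MvPolynomial.X (Sum.inr i)) = h.normalOrder A P * d i := by
  induction P using induction_rename_mul_rename with
  | mul p q =>
    rw [mul_assoc, ← MvPolynomial.rename_X, ← map_mul, normalOrder_rename_mul_rename,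
      normalOrder_rename_mul_rename, map_mul, dPoly_X, mul_assoc]
  | add P Q hP hQ => rw [add_mul, map_add, map_add, hP, hQ, add_mul]

/-- Together with `normalOrder_pderiv_inl`, this makes commutators with the generators lower the
degree of the symbol, which drives the induction behind Bernstein's inequality. -/
theorem normalOrder_pderiv_inr (h : IsWeylPair x d) (j : ι) (P : MvPolynomial (ι ⊕ ι) A) :
    h.normalOrder A (MvPolynomial.pderiv (Sum.inr j) P) =
      h.normalOrder A P * x j - x j * h.normalOrder A P := by
  induction P using induction_rename_mul_rename with
  | mul p q =>
    have hq := algHom_mul_sub_of_commutator (φ := h.dPoly A) h.dPoly_X (c := x j) (ε := 1) (j := j)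
      (fun i => by rw [h.d_x, map_one]) q
    have hp := algHom_mul_sub_of_commutator (φ := h.xPoly A) h.xPoly_X (c := x j) (ε := 0) (j := j)
      (fun i => by rw [h.x_comm]; simp) p
    rw [zero_smul, add_zero] at hp
    rw [MvPolynomial.pderiv_mul, pderiv_rename_of_notMem_range (by simp), zero_mul, zero_add,
      MvPolynomial.pderiv_rename Sum.inr_injective, normalOrder_rename_mul_rename,
      normalOrder_rename_mul_rename, mul_assoc, hq, one_smul, mul_add, ← mul_assoc, hp, mul_assoc,
      add_sub_cancel_left]
  | add P Q hP hQ => simp only [map_add, hP, hQ, add_mul, mul_add]; abel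

theorem normalOrder_pderiv_inl (h : IsWeylPair x d) (j : ι) (P : MvPolynomial (ι ⊕ ι) A) :
    h.normalOrder A (MvPolynomial.pderiv (Sum.inl j) P) =
      d j * h.normalOrder A P - h.normalOrder A P * d j := by
  induction P using induction_rename_mul_rename with
  | mul p q =>
    have hp := algHom_mul_sub_of_commutator (φ := h.xPoly A) h.xPoly_X (c := d j) (ε := -1) (j := j)
      (fun i => by rw [h.d_x]; by_cases hij : i = j <;> simp [hij, Ne.symm]) p
    have hq := algHom_mul_sub_of_commutator (φ := h.dPoly A) h.dPoly_X (c := d j) (ε := 0) (j := j)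
      (fun i => by rw [h.d_comm]; simp) q
    rw [zero_smul, add_zero] at hq
    rw [MvPolynomial.pderiv_mul, pderiv_rename_of_notMem_range (j := Sum.inl j) (f := Sum.inr)
      (by simp), mul_zero, add_zero, MvPolynomial.pderiv_rename Sum.inl_injective,
      normalOrder_rename_mul_rename, normalOrder_rename_mul_rename, mul_assoc, hq,
      ← mul_assoc (h.xPoly A p), hp, add_mul, neg_one_smul, neg_mul, mul_assoc]
    abel
  | add P Q hP hQ => simp only [map_add, hP, hQ, add_mul, mul_add]; abel

end IsWeylPair

end NormalOrder

end

/-! ### Bernstein's inequality over a principal ideal domain -/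

noncomputable section

theorem MvPolynomial.eq_C_of_pderiv_eq_zero {σ A : Type*} [CommRing A] [IsDomain A] [CharZero A]
    {P : MvPolynomial σ A}
    (h : ∀ i, MvPolynomial.pderiv i P = 0) : P = MvPolynomial.C (P.coeff 0) := by
  classical
  ext m
  rw [MvPolynomial.coeff_C]
  split_ifs with hm
  · rw [hm]
  · obtain ⟨i, hi⟩ : ∃ i, m i ≠ 0 := by
      by_contra! h0
      exact hm (Finsupp.ext h0).symm
    have h1 := MvPolynomial.coeff_pderiv P (i := i) (m - Finsupp.single i 1)
    rw [tsub_add_cancel_of_le (by simpa [Nat.one_le_iff_ne_zero] using hi), h i,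
      MvPolynomial.coeff_zero, eq_comm, mul_eq_zero] at h1
    -- Characteristic zero enters here: differentiation multiplies the coefficient by a positive
    -- exponent.
    exact h1.resolve_right (Nat.cast_add_one_ne_zero _)

theorem MvPolynomial.totalDegree_pderiv_le {σ A : Type*} [CommRing A] {P : MvPolynomial σ A} {N : ℕ}
    (hP : P.totalDegree ≤ N + 1) (i : σ) : (MvPolynomial.pderiv i P).totalDegree ≤ N := by
  classical
  refine Finset.sup_le fun m hm => ?_
  rw [MvPolynomial.mem_support_iff, MvPolynomial.coeff_pderiv] at hm
  have h1 := MvPolynomial.le_totalDegree (MvPolynomial.mem_support_iff.2 (left_ne_zero_of_mul hm))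
  have h2 : (m + Finsupp.single i 1).degree = m.degree + 1 := by simp
  change m.degree ≤ N
  change (m + Finsupp.single i 1).degree ≤ _ at h1
  omega

section Bernstein

variable {ι : Type*} [DecidableEq ι] {A : Type*} [CommRing A] {W : Type*} [AddCommGroup W]
  [Module A W] {x d : ι → Module.End A W} {Γ : ℕ → Submodule A W}

/-- An increasing filtration compatible with the degree of differential operators. -/
structure IsBernsteinFiltration (x d : ι → Module.End A W) (Γ : ℕ → Submodule A W) : Prop where
  mono : Monotone Γ
  x_mem : ∀ i k w, w ∈ Γ k → x i w ∈ Γ (k + 1)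
  d_mem : ∀ i k w, w ∈ Γ k → d i w ∈ Γ (k + 1)

namespace IsBernsteinFiltration

theorem normalOrder_monomial_mem (hΓ : IsBernsteinFiltration x d Γ) (h : IsWeylPair x d)
    (m : ι ⊕ ι →₀ ℕ) (k : ℕ) {w : W} (hw : w ∈ Γ k) :
    h.normalOrder A (MvPolynomial.monomial m 1) w ∈ Γ (k + m.degree) := by
  induction hN : m.degree generalizing m k w with
  | zero =>
    rw [Finsupp.degree_eq_zero_iff] at hN
    subst hN
    change h.normalOrder A (MvPolynomial.C 1) w ∈ _
    rw [h.normalOrder_C, map_one]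
    exact hw
  | succ N ih =>
    obtain ⟨l, hl⟩ : ∃ l, m l ≠ 0 := by
      by_contra! hm
      have : m = 0 := Finsupp.ext hm
      simp [this] at hN
    have hm : m - Finsupp.single l 1 + Finsupp.single l 1 = m :=
      tsub_add_cancel_of_le (by simpa [Nat.one_le_iff_ne_zero] using hl)
    generalize m - Finsupp.single l 1 = m' at hm
    subst hm
    have hN' : m'.degree = N := by simpa using hN
    have hmul : MvPolynomial.monomial (m' + Finsupp.single l 1) (1 : A) =
        MvPolynomial.monomial m' 1 * MvPolynomial.X l := by
      rw [MvPolynomial.X, MvPolynomial.monomial_mul, mul_one]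
    rw [hmul]
    -- Normal ordering lets an `x` be split off on the left and a `d` on the right; in the second
    -- case the induction runs with `d i w`, one level higher.
    rcases l with i | i
    · rw [mul_comm, h.normalOrder_X_inl_mul, Module.End.mul_apply, ← add_assoc]
      exact hΓ.x_mem i _ _ (ih m' k hw hN')
    · rw [h.normalOrder_mul_X_inr, Module.End.mul_apply, add_comm N, ← add_assoc]
      exact ih m' (k + 1) (hΓ.d_mem i _ _ hw) hN'

theorem normalOrder_mem (hΓ : IsBernsteinFiltration x d Γ) (h : IsWeylPair x d)
    {P : MvPolynomial (ι ⊕ ι) A} {N : ℕ} (hP : P.totalDegree ≤ N) (k : ℕ) {w : W} (hw : w ∈ Γ k) :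
    h.normalOrder A P w ∈ Γ (k + N) := by
  rw [P.as_sum, map_sum, LinearMap.sum_apply]
  refine Submodule.sum_mem _ fun m hm => ?_
  have : MvPolynomial.monomial m (P.coeff m) = P.coeff m • MvPolynomial.monomial m (1 : A) := by
    simp [MvPolynomial.smul_monomial]
  rw [this, map_smul, LinearMap.smul_apply]
  refine Submodule.smul_mem _ _ (hΓ.mono (Nat.add_le_add_left ?_ k)
    (hΓ.normalOrder_monomial_mem h m k hw))
  exact (MvPolynomial.le_totalDegree hm).trans hP

variable [IsDomain A] [CharZero A] [Module.IsTorsionFree A W]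

/-- If an operator kills `Γ (N + 1)`, its commutators with the generators kill `Γ N` and have
symbols of smaller degree. By induction all partial derivatives of the symbol vanish, so it is a
constant, and a constant killing `v ≠ 0` in a torsion-free module is zero. -/
theorem eq_zero_of_normalOrder_apply_eq_zero (hΓ : IsBernsteinFiltration x d Γ)
    (h : IsWeylPair x d) {v : W} (hv : v ∈ Γ 0) (hv0 : v ≠ 0) (N : ℕ)
    (P : MvPolynomial (ι ⊕ ι) A) (hP : P.totalDegree ≤ N)
    (hker : ∀ w ∈ Γ N, h.normalOrder A P w = 0) : P = 0 := by
  have const : ∀ (P : MvPolynomial (ι ⊕ ι) A) N, (∀ w ∈ Γ N, h.normalOrder A P w = 0) →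
      P = MvPolynomial.C (P.coeff 0) → P = 0 := by
    intro P N hker hC
    have h1 := hker v (hΓ.mono (Nat.zero_le N) hv)
    rw [hC, h.normalOrder_C, Module.algebraMap_end_apply, smul_eq_zero] at h1
    rw [hC, h1.resolve_right hv0, map_zero]
  induction N generalizing P with
  | zero => exact const P 0 hker (MvPolynomial.totalDegree_eq_zero_iff_eq_C.1 (Nat.le_zero.1 hP))
  | succ N ih =>
    refine const P (N + 1) hker (MvPolynomial.eq_C_of_pderiv_eq_zero fun l => ?_)
    have hdeg := MvPolynomial.totalDegree_pderiv_le hP l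
    have hker' : ∀ w ∈ Γ N, h.normalOrder A (MvPolynomial.pderiv l P) w = 0 := by
      intro w hw
      have hw' := hker w (hΓ.mono N.le_succ hw)
      rcases l with j | j
      · rw [h.normalOrder_pderiv_inl, LinearMap.sub_apply, Module.End.mul_apply,
          Module.End.mul_apply, hw', hker _ (hΓ.d_mem j N w hw), map_zero, sub_zero]
      · rw [h.normalOrder_pderiv_inr, LinearMap.sub_apply, Module.End.mul_apply,
          Module.End.mul_apply, hw', hker _ (hΓ.x_mem j N w hw), map_zero, sub_zero]
    exact ih _ hdeg hker'

variable [Fintype ι] [IsPrincipalIdealRing A]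

/-- **Bernstein's inequality**, in the form of a lower bound for the growth of a filtration. -/
theorem pow_le_finrank (hΓ : IsBernsteinFiltration x d Γ) (h : IsWeylPair x d)
    [hfin : ∀ k, Module.Finite A (Γ k)] {v : W} (hv : v ∈ Γ 0) (hv0 : v ≠ 0) (m : ℕ) :
    (m + 1) ^ Fintype.card ι ≤ Module.finrank A (Γ (4 * Fintype.card ι * m)) := by
  set n := Fintype.card ι
  -- With this `N`, every monomial in the `2n` letters with all exponents at most `m` has degree at
  -- most `N`; there are `(m + 1) ^ (2n)` of them.
  set N := 2 * n * m with hN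
  have hNN : 4 * n * m = N + N := by rw [hN]; ring
  rw [hNN]
  have hmem : ∀ P ∈ MvPolynomial.restrictTotalDegree (ι ⊕ ι) A N, ∀ w ∈ Γ N,
      h.normalOrder A P w ∈ Γ (N + N) := fun P hP w hw =>
    hΓ.normalOrder_mem h ((MvPolynomial.mem_restrictTotalDegree _ _ _).1 hP) N hw
  -- `Γ N` is finite and torsion-free over a principal ideal domain, hence free; an operator on it
  -- is recorded by the images of a basis.
  let b := Module.Free.chooseBasis A (Γ N)
  let T : MvPolynomial.restrictTotalDegree (ι ⊕ ι) A N →ₗ[A]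
      (Module.Free.ChooseBasisIndex A (Γ N) → Γ (N + N)) :=
    LinearMap.pi fun j => LinearMap.codRestrict _
      ((LinearMap.applyₗ (b j : W)) ∘ₗ (h.normalOrder A) ∘ₗ Submodule.subtype _)
      (fun P => hmem P P.2 _ (b j).2)
  have hT : Function.Injective T := by
    rw [← LinearMap.ker_eq_bot, LinearMap.ker_eq_bot']
    intro P hP
    have hPj : ∀ j, h.normalOrder A P (b j : W) = 0 := fun j =>
      congrArg Subtype.val (congrFun hP j)
    apply Subtype.ext
    refine hΓ.eq_zero_of_normalOrder_apply_eq_zero h hv hv0 N P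
      ((MvPolynomial.mem_restrictTotalDegree _ _ _).1 P.2) fun w hw => ?_
    have : (h.normalOrder A P) ∘ₗ (Γ N).subtype = 0 := b.ext fun j => hPj j
    exact LinearMap.congr_fun this ⟨w, hw⟩
  let e : (ι ⊕ ι → Fin (m + 1)) → MvPolynomial.restrictTotalDegree (ι ⊕ ι) A N := fun t =>
    ⟨MvPolynomial.monomial (Finsupp.equivFunOnFinite.symm fun l => (t l : ℕ)) 1, by
      rw [MvPolynomial.mem_restrictTotalDegree]
      refine (MvPolynomial.totalDegree_monomial_le _ _).trans ?_
      rw [Finsupp.sum_fintype _ _ (fun _ => rfl)]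
      refine (Finset.sum_le_card_nsmul _ _ m fun l _ => ?_).trans ?_
      · simpa using Nat.lt_succ_iff.1 (t l).2
      · simp [hN, n, two_mul]⟩
  have he : LinearIndependent A e := by
    refine LinearIndependent.of_comp (Submodule.subtype _) ?_
    refine (MvPolynomial.basisMonomials (ι ⊕ ι) A).linearIndependent.comp
      (fun t : ι ⊕ ι → Fin (m + 1) => Finsupp.equivFunOnFinite.symm fun l => (t l : ℕ)) ?_
    intro s t hst
    funext l
    exact Fin.ext (congrFun (Finsupp.equivFunOnFinite.symm.injective hst) l)
  have hcard := (he.map' T (LinearMap.ker_eq_bot.2 hT)).fintype_card_le_finrank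
  have hle : Module.finrank A (Γ N) ≤ Module.finrank A (Γ (N + N)) :=
    Submodule.finrank_mono (hΓ.mono (Nat.le_add_right N N))
  rw [Module.finrank_pi_fintype, Finset.sum_const, Finset.card_univ,
    ← Module.finrank_eq_card_chooseBasisIndex, Fintype.card_fun, Fintype.card_fin,
    Fintype.card_sum, smul_eq_mul, pow_add] at hcard
  exact Nat.mul_self_le_mul_self_iff.1 (hcard.trans (Nat.mul_le_mul_right _ hle))

end IsBernsteinFiltration

end Bernstein

end

/-! ### Growth along chains of saturated submodules -/

noncomputable section

section Chains

variable {ι : Type*} [DecidableEq ι] [Fintype ι] {A : Type*} [CommRing A] [IsDomain A] [CharZero A]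
  [IsPrincipalIdealRing A] {M : Type*} [AddCommGroup M] [Module A M]
  {x d : ι → Module.End A M} {Γ : ℕ → Submodule A M}

namespace IsBernsteinFiltration

/-- Bernstein's inequality is applied in `M ⧸ N'`, torsion-free because `N'` is saturated, to the
images of `Γ (k + k₀) ⊓ N`. The shift by `k₀` puts the class of `u` at level zero, and the
filtration need not exhaust the quotient. Additivity of rank then gives the bound. -/
theorem finrank_inf_add_pow_le (hΓ : IsBernsteinFiltration x d Γ) (h : IsWeylPair x d)
    [hfin : ∀ k, Module.Finite A (Γ k)] {N N' : Submodule A M} (hle : N' ≤ N)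
    (hx : ∀ i, ∀ u ∈ N, x i u ∈ N) (hd : ∀ i, ∀ u ∈ N, d i u ∈ N)
    (hx' : ∀ i, ∀ u ∈ N', x i u ∈ N') (hd' : ∀ i, ∀ u ∈ N', d i u ∈ N')
    (htf : ∀ (a : A) (u : M), a ≠ 0 → a • u ∈ N' → u ∈ N') {k₀ : ℕ} {u : M} (hu : u ∈ N)
    (hu' : u ∉ N') (huΓ : u ∈ Γ k₀) (m : ℕ) :
    Module.finrank A ↥(Γ (4 * Fintype.card ι * m + k₀) ⊓ N') + (m + 1) ^ Fintype.card ι ≤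
      Module.finrank A ↥(Γ (4 * Fintype.card ι * m + k₀) ⊓ N) := by
  have hfinN : ∀ (k) (L : Submodule A M), Module.Finite A ↥(Γ k ⊓ L) := fun k L =>
    Module.Finite.of_injective (Submodule.inclusion inf_le_left) (Submodule.inclusion_injective _)
  have : Module.IsTorsionFree A (M ⧸ N') := by
    refine .of_smul_eq_zero fun a w haw => ?_
    obtain ⟨w, rfl⟩ := N'.mkQ_surjective w
    by_cases ha : a = 0
    · exact Or.inl ha
    · right
      rw [← map_smul, Submodule.mkQ_apply, Submodule.Quotient.mk_eq_zero] at haw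
      rw [Submodule.mkQ_apply, Submodule.Quotient.mk_eq_zero]
      exact htf a w ha haw
  have hW : IsWeylPair (fun i => N'.mapQ N' (x i) (hx' i)) (fun i => N'.mapQ N' (d i) (hd' i)) := by
    refine ⟨fun i j => ?_, fun i j => ?_, fun i j => ?_⟩
    · ext w
      simpa using congrArg (Submodule.Quotient.mk (p := N')) (LinearMap.congr_fun (h.x_comm i j) w)
    · ext w
      simpa using congrArg (Submodule.Quotient.mk (p := N')) (LinearMap.congr_fun (h.d_comm i j) w)
    · ext w
      have := congrArg (Submodule.Quotient.mk (p := N')) (LinearMap.congr_fun (h.d_x i j) w)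
      split_ifs at this ⊢ <;> simpa using this
  have hF : IsBernsteinFiltration (fun i => N'.mapQ N' (x i) (hx' i))
      (fun i => N'.mapQ N' (d i) (hd' i)) (fun k => (Γ (k + k₀) ⊓ N).map N'.mkQ) := by
    refine ⟨fun a b hab => Submodule.map_mono (inf_le_inf_right _ (hΓ.mono (by omega))), ?_, ?_⟩
    · rintro i k _ ⟨w, hw, rfl⟩
      exact ⟨x i w, ⟨by rw [add_right_comm]; exact hΓ.x_mem i _ w hw.1, hx i w hw.2⟩, rfl⟩
    · rintro i k _ ⟨w, hw, rfl⟩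
      exact ⟨d i w, ⟨by rw [add_right_comm]; exact hΓ.d_mem i _ w hw.1, hd i w hw.2⟩, rfl⟩
  have hlow := hF.pow_le_finrank hW (v := N'.mkQ u) ⟨u, ⟨by simpa using huΓ, hu⟩, rfl⟩
    (by rwa [Submodule.mkQ_apply, Ne, Submodule.Quotient.mk_eq_zero]) m
  set k := 4 * Fintype.card ι * m + k₀
  have hrange := (LinearMap.ker (N'.mkQ ∘ₗ (Γ k ⊓ N).subtype)).finrank_quotient_add_finrank
  rw [(N'.mkQ ∘ₗ (Γ k ⊓ N).subtype).quotKerEquivRange.finrank_eq, LinearMap.range_comp, Submodule.range_subtype] at hrange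
  have hker : Module.finrank A ↥(Γ k ⊓ N') ≤
      Module.finrank A (LinearMap.ker (N'.mkQ ∘ₗ (Γ k ⊓ N).subtype)) := by
    refine LinearMap.finrank_le_finrank_of_injective
      (f := (Submodule.inclusion (inf_le_inf_left (Γ k) hle)).codRestrict _ fun w => ?_) ?_
    · simpa [Submodule.Quotient.mk_eq_zero] using w.2.2
    · intro a b hab
      exact Subtype.ext (congrArg (fun t => ((t : ↥(Γ k ⊓ N)) : M)) (congrArg Subtype.val hab))
  omega

/-- Each of the first `r` strict steps contributes `(m + 1) ^ n`; the common level `k₀` for all the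
witnesses lets the bounds telescope. -/
theorem mul_pow_le_finrank (hΓ : IsBernsteinFiltration x d Γ) (h : IsWeylPair x d)
    [hfin : ∀ k, Module.Finite A (Γ k)] {N : ℕ → Submodule A M} (hN : Antitone N)
    (hx : ∀ k i, ∀ u ∈ N k, x i u ∈ N k) (hd : ∀ k i, ∀ u ∈ N k, d i u ∈ N k)
    (htf : ∀ k (a : A) (u : M), a ≠ 0 → a • u ∈ N k → u ∈ N k) {k₀ r : ℕ} {u : ℕ → M}
    (hu : ∀ k, u k ∈ N k) (hu' : ∀ k, u k ∉ N (k + 1)) (huΓ : ∀ k < r, u k ∈ Γ k₀) (m : ℕ) :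
    r * (m + 1) ^ Fintype.card ι ≤ Module.finrank A (Γ (4 * Fintype.card ι * m + k₀)) := by
  set k := 4 * Fintype.card ι * m + k₀ with hk
  have key : ∀ s ≤ r, Module.finrank A ↥(Γ k ⊓ N s) + s * (m + 1) ^ Fintype.card ι ≤
      Module.finrank A ↥(Γ k) := by
    intro s hs
    induction s with
    | zero => simpa using Submodule.finrank_mono inf_le_left
    | succ s ih =>
      have h1 := hΓ.finrank_inf_add_pow_le h (hN s.le_succ) (hx s) (hd s) (hx _) (hd _) (htf _)
        (hu s) (hu' s) (huΓ s (by omega)) m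
      have h2 := ih (by omega)
      rw [← hk] at h1
      rw [add_mul, one_mul]
      simp only [Nat.succ_eq_add_one] at h1
      omega
  have := key r le_rfl
  omega

end IsBernsteinFiltration

end Chains

/-! ### Polynomials of bounded degree in each variable -/

section FilteredLocalization

namespace MvPolynomial

variable {σ A : Type*} [CommRing A]

theorem mem_restrictDegree_iff_degreeOf_le (p : MvPolynomial σ A) (k : ℕ) :
    p ∈ restrictDegree σ A k ↔ ∀ i, p.degreeOf i ≤ k := by
  rw [mem_restrictDegree]
  simp only [degreeOf_le_iff]
  exact ⟨fun h i m hm => h m hm i, fun h m hm i => h i m hm⟩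

theorem mul_mem_restrictDegree {p q : MvPolynomial σ A} {k l : ℕ} (hp : p ∈ restrictDegree σ A k)
    (hq : q ∈ restrictDegree σ A l) : p * q ∈ restrictDegree σ A (k + l) := by
  rw [mem_restrictDegree_iff_degreeOf_le] at *
  exact fun i => (degreeOf_mul_le i p q).trans (add_le_add (hp i) (hq i))

theorem restrictDegree_mono {k l : ℕ} (h : k ≤ l) : restrictDegree σ A k ≤ restrictDegree σ A l :=
  fun p hp => by
    rw [mem_restrictDegree_iff_degreeOf_le] at *
    exact fun i => (hp i).trans h

theorem pderiv_mem_restrictDegree {p : MvPolynomial σ A} {k : ℕ} (hp : p ∈ restrictDegree σ A k)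
    (i : σ) : pderiv i p ∈ restrictDegree σ A k := by
  classical
  rw [mem_restrictDegree] at *
  intro m hm j
  rw [mem_support_iff, coeff_pderiv] at hm
  exact (Nat.le_add_right _ _).trans (hp _ (mem_support_iff.2 (left_ne_zero_of_mul hm)) j)

theorem X_mem_restrictDegree (i : σ) : (X i : MvPolynomial σ A) ∈ restrictDegree σ A 1 :=
  restrictTotalDegree_le_restrictDegree _ _ _ ((mem_restrictTotalDegree _ _ _).2
    ((totalDegree_monomial_le _ _).trans (by simp)))

theorem pow_mem_restrictDegree {p : MvPolynomial σ A} {k : ℕ} (hp : p ∈ restrictDegree σ A k)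
    (m : ℕ) : p ^ m ∈ restrictDegree σ A (m * k) := by
  rw [mem_restrictDegree_iff_degreeOf_le] at *
  exact fun i => (degreeOf_pow_le i p m).trans (Nat.mul_le_mul_left m (hp i))

theorem finrank_restrictDegree_le [Fintype σ] [Nontrivial A] (k : ℕ) :
    Module.finrank A (restrictDegree σ A k) ≤ (k + 1) ^ Fintype.card σ := by
  rw [restrictDegree, Module.finrank_eq_nat_card_basis (basisRestrictSupport A _)]
  have hinj : Function.Injective fun (s : {m : σ →₀ ℕ | ∀ i, m i ≤ k}) (i : σ) =>
      (⟨s.1 i, Nat.lt_succ_of_le (s.2 i)⟩ : Fin (k + 1)) := fun s t hst =>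
    Subtype.ext (Finsupp.ext fun i => congrArg Fin.val (congrFun hst i))
  classical
  refine (Nat.card_le_card_of_injective _ hinj).trans (le_of_eq ?_)
  simp

end MvPolynomial

end FilteredLocalization
end

/-! ### The pole filtration of `R_n[s, 1/f]` -/

noncomputable section

section PoleFiltration

variable {K : Type*} [Field K] {n : ℕ} (f : MvPolynomial (Fin n) K)

theorem weylAct_x (i : Fin n) : weylAct f (WeylAlgebra.x K i) = letterAct f (Sum.inl i) :=
  (RingQuot.liftAlgHom_mkAlgHom_apply K _ _ _).trans (FreeAlgebra.lift_ι_apply _ _)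

theorem weylAct_d (i : Fin n) : weylAct f (WeylAlgebra.d K i) = letterAct f (Sum.inr i) :=
  (RingQuot.liftAlgHom_mkAlgHom_apply K _ _ _).trans (FreeAlgebra.lift_ι_apply _ _)

theorem isWeylPair_weylAlgebra :
    IsWeylPair (WeylAlgebra.x K (n := n)) (WeylAlgebra.d K (n := n)) where
  x_comm i j := WeylAlgebra.x_mul_x K j i
  d_comm i j := by
    have h := RingQuot.mkAlgHom_rel K (WeylRel.d_comm (K := K) j i)
    rwa [map_mul, map_mul] at h
  d_x i j := by
    have h := RingQuot.mkAlgHom_rel K (WeylRel.d_x (K := K) i j)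
    rw [map_add, map_mul, map_mul] at h
    split_ifs at h ⊢
    · rwa [map_one] at h
    · rwa [map_zero] at h

theorem isWeylPair_letterAct :
    IsWeylPair (fun i => letterAct f (Sum.inl i)) (fun i => letterAct f (Sum.inr i)) where
  x_comm i j := by
    simpa [weylAct_x] using congrArg (weylAct f) ((isWeylPair_weylAlgebra (K := K)).x_comm i j)
  d_comm i j := by
    simpa [weylAct_d] using congrArg (weylAct f) ((isWeylPair_weylAlgebra (K := K)).d_comm i j)
  d_x i j := by
    have h := congrArg (weylAct f) ((isWeylPair_weylAlgebra (K := K)).d_x i j)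
    split_ifs at h ⊢ <;> simpa [weylAct_d, weylAct_x] using h

theorem algebraMap_toRs_mul_invSelf :
    algebraMap _ (RsInv f) (toRs f) * IsLocalization.Away.invSelf (toRs f) = 1 :=
  IsLocalization.Away.mul_invSelf (toRs f)

theorem partialRs_invSelf (i : Fin n) :
    partialRs f i (IsLocalization.Away.invSelf (toRs f)) =
      -(IsLocalization.Away.invSelf (toRs f)) ^ 2 *
        algebraMap _ (RsInv f) (toRs (MvPolynomial.pderiv i f)) := by
  have hu := algebraMap_toRs_mul_invSelf f
  have h := congrArg (partialRs f i) hu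
  simp only [Derivation.leibniz, partialRs_algebraMap, pderiv_toRs, smul_eq_mul,
    Derivation.map_one_eq_zero] at h
  linear_combination (IsLocalization.Away.invSelf (toRs f)) * h -
    (partialRs f i (IsLocalization.Away.invSelf (toRs f))) * hu

theorem partialRs_invSelf_pow (i : Fin n) (k : ℕ) :
    partialRs f i (IsLocalization.Away.invSelf (toRs f) ^ k) =
      -(k : RsInv f) * IsLocalization.Away.invSelf (toRs f) ^ (k + 1) *
        algebraMap _ (RsInv f) (toRs (MvPolynomial.pderiv i f)) := by
  induction k with
  | zero => simp
  | succ k ih =>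
    rw [pow_succ, Derivation.leibniz, ih, partialRs_invSelf, smul_eq_mul, smul_eq_mul]
    push_cast
    ring

/-- The filtration of `R_n[s, 1/f]` by the order of the pole along `f`. -/
def poleFiltration (k : ℕ) : Submodule K[X] (RsInv f) :=
  (MvPolynomial.restrictDegree (Fin n) K[X] (k * (f.totalDegree + 1))).map
    (LinearMap.mulRight K[X] (IsLocalization.Away.invSelf (toRs f) ^ k) ∘ₗ
      (IsScalarTower.toAlgHom K[X] (MvPolynomial (Fin n) K[X]) (RsInv f)).toLinearMap)

variable {f}

theorem mem_poleFiltration {k : ℕ} {u : RsInv f} :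
    u ∈ poleFiltration f k ↔
      ∃ g ∈ MvPolynomial.restrictDegree (Fin n) K[X] (k * (f.totalDegree + 1)),
        algebraMap _ (RsInv f) g * IsLocalization.Away.invSelf (toRs f) ^ k = u :=
  Iff.rfl

instance (k : ℕ) : Module.Finite K[X] (poleFiltration f k) :=
  Module.Finite.map _ _

theorem finrank_poleFiltration_le (k : ℕ) :
    Module.finrank K[X] (poleFiltration f k) ≤ (k * (f.totalDegree + 1) + 1) ^ n := by
  refine (Submodule.finrank_map_le _ _).trans ?_
  simpa using MvPolynomial.finrank_restrictDegree_le (σ := Fin n) (A := K[X])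
    (k * (f.totalDegree + 1))

theorem toRs_mem_restrictDegree (g : MvPolynomial (Fin n) K) :
    toRs g ∈ MvPolynomial.restrictDegree (Fin n) K[X] g.totalDegree :=
  MvPolynomial.restrictTotalDegree_le_restrictDegree _ _ _
    ((MvPolynomial.mem_restrictTotalDegree _ _ _).2
      (Finset.sup_mono (MvPolynomial.support_map_subset _ _)))

/-- Going up one level multiplies the numerator by `f` or a derivative of `f`, which costs at most
`f.totalDegree`, and the letter `x_i` costs one more; hence the slope `f.totalDegree + 1`. -/
theorem isBernsteinFiltration_poleFiltration :
    IsBernsteinFiltration (fun i => letterAct f (Sum.inl i)) (fun i => letterAct f (Sum.inr i))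
      (poleFiltration f) where
  mono := by
    refine monotone_nat_of_le_succ fun k u hu => ?_
    obtain ⟨g, hg, rfl⟩ := mem_poleFiltration.1 hu
    refine mem_poleFiltration.2 ⟨g * toRs f, MvPolynomial.restrictDegree_mono ?_
      (MvPolynomial.mul_mem_restrictDegree hg (toRs_mem_restrictDegree f)), ?_⟩
    · rw [add_mul]; omega
    · rw [map_mul]
      linear_combination (algebraMap _ (RsInv f) g * IsLocalization.Away.invSelf (toRs f) ^ k) *
        algebraMap_toRs_mul_invSelf f
  x_mem := by
    intro i k u hu
    obtain ⟨g, hg, rfl⟩ := mem_poleFiltration.1 hu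
    refine mem_poleFiltration.2 ⟨MvPolynomial.X i * (g * toRs f), MvPolynomial.restrictDegree_mono ?_
      (MvPolynomial.mul_mem_restrictDegree (MvPolynomial.X_mem_restrictDegree i)
        (MvPolynomial.mul_mem_restrictDegree hg (toRs_mem_restrictDegree f))), ?_⟩
    · rw [add_mul]; omega
    · simp only [letterAct, LinearMap.mulLeft_apply, map_mul]
      linear_combination (algebraMap (MvPolynomial (Fin n) K[X]) (RsInv f) (MvPolynomial.X i) *
        algebraMap _ (RsInv f) g * IsLocalization.Away.invSelf (toRs f) ^ k) * algebraMap_toRs_mul_invSelf f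
  d_mem := by
    intro i k u hu
    obtain ⟨g, hg, rfl⟩ := mem_poleFiltration.1 hu
    have hf' : toRs (MvPolynomial.pderiv i f) ∈
        MvPolynomial.restrictDegree (Fin n) K[X] f.totalDegree := by
      rw [← pderiv_toRs]
      exact MvPolynomial.pderiv_mem_restrictDegree (toRs_mem_restrictDegree f) i
    -- The numerator comes from `∂_i (g f^(-k) · f^s) = (f ∂_i g + (s - k) g ∂_i f) f^(-k-1) · f^s`.
    refine mem_poleFiltration.2 ⟨MvPolynomial.pderiv i g * toRs f +
      (X - (k : K[X])) • (g * toRs (MvPolynomial.pderiv i f)), MvPolynomial.restrictDegree_mono ?_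
      (Submodule.add_mem _ (MvPolynomial.mul_mem_restrictDegree
        (MvPolynomial.pderiv_mem_restrictDegree hg i) (toRs_mem_restrictDegree f))
        (Submodule.smul_mem _ _ (MvPolynomial.mul_mem_restrictDegree hg hf'))), ?_⟩
    · rw [add_mul]; omega
    · simp only [letterAct, LinearMap.add_apply, LinearMap.mulLeft_apply, Derivation.coeFn_coe,
        Derivation.leibniz, partialRs_algebraMap, partialRs_invSelf_pow, fsLogDeriv, smul_eq_mul,
        map_add, map_mul, Algebra.smul_def, map_sub, map_natCast,
        ← IsScalarTower.algebraMap_apply]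
      linear_combination (algebraMap _ (RsInv f) (MvPolynomial.pderiv i g) *
        IsLocalization.Away.invSelf (toRs f) ^ k) * algebraMap_toRs_mul_invSelf f

theorem algebraMap_toRs_pow_mem_poleFiltration {k k₀ : ℕ} (hk : k * f.totalDegree ≤ k₀) :
    algebraMap _ (RsInv f) (toRs f) ^ k ∈ poleFiltration f k₀ := by
  -- As `f^(k + k₀) / f^k₀`, the degree condition is `(k + k₀) deg f ≤ k₀ (deg f + 1)`, which is
  -- `hk`.
  refine mem_poleFiltration.2 ⟨toRs f ^ (k + k₀), MvPolynomial.restrictDegree_mono ?_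
    (MvPolynomial.pow_mem_restrictDegree (toRs_mem_restrictDegree f) _), ?_⟩
  · rw [add_mul, mul_add]; omega
  · rw [map_pow, pow_add, mul_assoc, ← mul_pow, algebraMap_toRs_mul_invSelf, one_pow, mul_one]

end PoleFiltration

end

/-! ### Saturated submodules and stabilization of the chain of powers of `f` -/

noncomputable section

section Saturated

variable {K : Type*} [Field K] {n : ℕ} {f : MvPolynomial (Fin n) K}

theorem algebraMap_C (c : K) :
    algebraMap K[X] (RsInv f) (C c) = algebraMap K (RsInv f) c :=
  (IsScalarTower.algebraMap_apply K K[X] (RsInv f) c).symm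

theorem weylSAct_C (a : WeylAlgebra K n) : weylSAct f (C a) = weylAct f a := by
  simp [weylSAct, eval₂RingHom']

theorem weylSAct_X (u : RsInv f) : weylSAct f X u = (X : K[X]) • u := by
  simp [weylSAct, eval₂RingHom']

theorem weylSAct_ofS (a : K[X]) (u : RsInv f) :
    weylSAct f (WeylAlgebra.ofS K n a) u = a • u := by
  have : (weylSAct f).comp (WeylAlgebra.ofS K n : K[X] →+* (WeylAlgebra K n)[X]) =
      algebraMap K[X] (Module.End K[X] (RsInv f)) := by
    refine Polynomial.ringHom_ext (fun c => ?_) ?_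
    · ext u
      simp [WeylAlgebra.ofS, weylSAct_C, Algebra.smul_def, algebraMap_C]
    · ext u
      simp [WeylAlgebra.ofS, weylSAct_X]
  exact LinearMap.congr_fun (RingHom.congr_fun this a) u

theorem weylAct_ofPoly (g : MvPolynomial (Fin n) K) (u : RsInv f) :
    weylAct f (WeylAlgebra.ofPoly K n g) u = algebraMap _ (RsInv f) (toRs g) * u := by
  induction g using MvPolynomial.induction_on generalizing u with
  | C c =>
    have h : toRs (MvPolynomial.C c : MvPolynomial (Fin n) K) = algebraMap K[X] _ (C c) :=
      MvPolynomial.map_C _ _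
    rw [h, ← IsScalarTower.algebraMap_apply, algebraMap_C, ← MvPolynomial.algebraMap_eq,
      AlgHom.commutes, AlgHom.commutes, Module.algebraMap_end_apply, Algebra.smul_def]
  | add p q hp hq => simp only [map_add, LinearMap.add_apply, hp, hq, toRs, add_mul]
  | mul_X p i hp =>
    simp only [map_mul, WeylAlgebra.ofPoly_X, weylAct_x, toRs, MvPolynomial.map_X, letterAct,
      mul_assoc]
    exact hp _

theorem weylSAct_polyInWeylS (u : RsInv f) :
    weylSAct f (polyInWeylS f) u = algebraMap _ (RsInv f) (toRs f) * u := by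
  rw [polyInWeylS, weylSAct_C, weylAct_ofPoly]

variable (f) in
/-- The elements of `R_n[s, 1/f] · f^s` with a nonzero `K[s]`-multiple in `D_n[s] u`. -/
def torsionClosure (u : RsInv f) : Submodule K[X] (RsInv f) where
  carrier := {v | ∃ a : K[X], a ≠ 0 ∧ ∃ P : (WeylAlgebra K n)[X], a • v = weylSAct f P u}
  zero_mem' := ⟨1, one_ne_zero, 0, by simp⟩
  add_mem' := by
    rintro v w ⟨a, ha, P, hP⟩ ⟨b, hb, Q, hQ⟩
    refine ⟨a * b, mul_ne_zero ha hb,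
      WeylAlgebra.ofS K n b * P + WeylAlgebra.ofS K n a * Q, ?_⟩
    simp only [map_add, map_mul, LinearMap.add_apply, Module.End.mul_apply, weylSAct_ofS, ← hP,
      ← hQ, smul_add, smul_smul, mul_comm a b]
  smul_mem' := by
    rintro c v ⟨a, ha, P, hP⟩
    refine ⟨a, ha, WeylAlgebra.ofS K n c * P, ?_⟩
    rw [map_mul, Module.End.mul_apply, weylSAct_ofS, ← hP, smul_comm]

theorem self_mem_torsionClosure (u : RsInv f) : u ∈ torsionClosure f u :=
  ⟨1, one_ne_zero, 1, by simp⟩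

theorem weylAct_mem_torsionClosure {u v : RsInv f} (hv : v ∈ torsionClosure f u)
    (D : WeylAlgebra K n) : weylAct f D v ∈ torsionClosure f u := by
  obtain ⟨a, ha, P, hP⟩ := hv
  refine ⟨a, ha, C D * P, ?_⟩
  rw [map_mul, Module.End.mul_apply, weylSAct_C, ← hP, map_smul]

theorem mem_torsionClosure_of_smul_mem {u v : RsInv f} {a : K[X]} (ha : a ≠ 0)
    (hv : a • v ∈ torsionClosure f u) : v ∈ torsionClosure f u := by
  obtain ⟨b, hb, P, hP⟩ := hv
  exact ⟨b * a, mul_ne_zero hb ha, P, by rw [mul_smul, hP]⟩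

theorem torsionClosure_toRs_mul_le (u : RsInv f) :
    torsionClosure f (algebraMap _ (RsInv f) (toRs f) * u) ≤ torsionClosure f u := by
  rintro v ⟨a, ha, P, hP⟩
  exact ⟨a, ha, P * polyInWeylS f, by
    rw [map_mul, Module.End.mul_apply, weylSAct_polyInWeylS, hP]⟩

/-- Otherwise the closures of the powers of `f` decrease strictly at every step, and `r` steps force
rank at least `r (m + 1) ^ n` in a filtration whose ranks allow only `B ^ n (m + 1) ^ n`. -/
theorem exists_pow_mem_torsionClosure [CharZero K] (f : MvPolynomial (Fin n) K) :
    ∃ k : ℕ, algebraMap _ (RsInv f) (toRs f) ^ k ∈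
      torsionClosure f (algebraMap _ (RsInv f) (toRs f) ^ (k + 1)) := by
  by_contra! hcon
  set D := f.totalDegree with hD
  set B := (4 * n + 1) * (D + 1) + 1 with hB
  -- The powers `f^k` with `k < r` all lie at level `k₀ = r D`. Taking `m = r D` too, the level
  -- reached is `(4n + 1) r D`, whose rank is at most `(B (m + 1)) ^ n`; so `r > B ^ n` is a
  -- contradiction.
  set r := B ^ n + 1 with hr
  have hle := isBernsteinFiltration_poleFiltration (f := f).mul_pow_le_finrank
    (isWeylPair_letterAct f)
    (N := fun k => torsionClosure f (algebraMap _ (RsInv f) (toRs f) ^ k))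
    (antitone_nat_of_succ_le fun k => by
      rw [pow_succ']
      exact torsionClosure_toRs_mul_le _)
    (fun k i u hu => by rw [← weylAct_x]; exact weylAct_mem_torsionClosure hu _)
    (fun k i u hu => by rw [← weylAct_d]; exact weylAct_mem_torsionClosure hu _)
    (fun k a u ha hu => mem_torsionClosure_of_smul_mem ha hu)
    (u := fun k => algebraMap _ (RsInv f) (toRs f) ^ k) (k₀ := r * D) (r := r)
    (fun k => self_mem_torsionClosure _) hcon
    (fun k hk => algebraMap_toRs_pow_mem_poleFiltration (Nat.mul_le_mul_right _ hk.le)) (r * D)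
  rw [Fintype.card_fin] at hle
  have h1 := hle.trans (finrank_poleFiltration_le _)
  have h2 : (4 * n * (r * D) + r * D) * (D + 1) + 1 ≤ B * (r * D + 1) := by
    rw [hB]
    nlinarith [Nat.zero_le ((4 * n + 1) * (D + 1)), Nat.zero_le (r * D)]
  have h3 := h1.trans (Nat.pow_le_pow_left h2 n)
  rw [mul_pow] at h3
  have h4 := Nat.le_of_mul_le_mul_right h3 (by positivity)
  omega

end Saturated

/-! ### The substitution `s ↦ s - k` and existence of a solution of Bernstein's equation -/

section Shift

variable {K : Type*} [Field K] {n : ℕ} (f : MvPolynomial (Fin n) K)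

theorem map_compRingHom_toRs (p : K[X]) (g : MvPolynomial (Fin n) K) :
    MvPolynomial.map (compRingHom p) (toRs g) = toRs g := by
  rw [toRs, MvPolynomial.map_map]
  congr 1
  congr 1
  ext c
  simp

/-- The substitution `s ↦ p(s)` on `R_n[s, 1/f]`. -/
def substS (p : K[X]) : RsInv f →+* RsInv f :=
  IsLocalization.Away.lift (toRs f)
    (g := (algebraMap (MvPolynomial (Fin n) K[X]) (RsInv f)).comp
      (MvPolynomial.map (compRingHom p)))
    (by
      rw [RingHom.comp_apply, map_compRingHom_toRs]
      exact IsLocalization.Away.algebraMap_isUnit (S := RsInv f) (toRs f))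

variable {f}

theorem substS_algebraMap (p : K[X]) (g : MvPolynomial (Fin n) K[X]) :
    substS f p (algebraMap _ (RsInv f) g) =
      algebraMap _ (RsInv f) (MvPolynomial.map (compRingHom p) g) := by
  simp [substS, IsLocalization.Away.lift_eq]

theorem substS_toRs (p : K[X]) (g : MvPolynomial (Fin n) K) :
    substS f p (algebraMap _ (RsInv f) (toRs g)) = algebraMap _ (RsInv f) (toRs g) := by
  rw [substS_algebraMap, map_compRingHom_toRs]

theorem substS_smul (p a : K[X]) (u : RsInv f) : substS f p (a • u) = a.comp p • substS f p u := by
  rw [Algebra.smul_def, Algebra.smul_def, map_mul,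
    IsScalarTower.algebraMap_apply K[X] (MvPolynomial (Fin n) K[X]) (RsInv f), substS_algebraMap,
    IsScalarTower.algebraMap_apply K[X] (MvPolynomial (Fin n) K[X]) (RsInv f)]
  simp

theorem substS_invSelf (p : K[X]) :
    substS f p (IsLocalization.Away.invSelf (toRs f)) = IsLocalization.Away.invSelf (toRs f) := by
  have h1 := congrArg (substS f p) (algebraMap_toRs_mul_invSelf f)
  rw [map_mul, map_one, substS_toRs] at h1
  have h2 := algebraMap_toRs_mul_invSelf f
  linear_combination IsLocalization.Away.invSelf (toRs f) * h1 -
    substS f p (IsLocalization.Away.invSelf (toRs f)) * h2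

theorem exists_eq_algebraMap_mul_invSelf_pow (u : RsInv f) :
    ∃ (g : MvPolynomial (Fin n) K[X]) (k : ℕ),
      u = algebraMap _ (RsInv f) g * IsLocalization.Away.invSelf (toRs f) ^ k := by
  obtain ⟨k, g, h⟩ := IsLocalization.Away.surj (toRs f) u
  refine ⟨g, k, ?_⟩
  rw [← h, mul_assoc, ← mul_pow, algebraMap_toRs_mul_invSelf, one_pow, mul_one]

theorem partialRs_substS (p : K[X]) (i : Fin n) (u : RsInv f) :
    partialRs f i (substS f p u) = substS f p (partialRs f i u) := by
  obtain ⟨g, k, rfl⟩ := exists_eq_algebraMap_mul_invSelf_pow u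
  simp only [map_mul, map_pow, substS_invSelf, substS_algebraMap, Derivation.leibniz,
    partialRs_invSelf_pow, partialRs_algebraMap, smul_eq_mul, map_add, map_neg, map_natCast,
    MvPolynomial.pderiv_map, map_compRingHom_toRs]

variable (f) in
/-- The substitution `s ↦ s - k` on `R_n[s, 1/f] · f^s`, which maps `g(s) · f^s` to
`g(s - k) f^{-k} · f^s`. -/
def shift (k : ℕ) : RsInv f →+ RsInv f :=
  (AddMonoidHom.mulRight (IsLocalization.Away.invSelf (toRs f) ^ k)).comp
    (substS f (X - C (k : K))).toAddMonoidHom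

theorem shift_apply (k : ℕ) (u : RsInv f) :
    shift f k u = substS f (X - C (k : K)) u * IsLocalization.Away.invSelf (toRs f) ^ k := rfl

theorem shift_smul (k : ℕ) (a : K[X]) (u : RsInv f) :
    shift f k (a • u) = a.comp (X - C (k : K)) • shift f k u := by
  rw [shift_apply, shift_apply, substS_smul, smul_mul_assoc]

/-- Differentiating the factor `f^(-k)` produces `-k (∂_i f) / f`, exactly the change in `s (∂_i f)
/ f` under `s ↦ s - k`. -/
theorem shift_letterAct (k : ℕ) (l : Fin n ⊕ Fin n) (u : RsInv f) :
    shift f k (letterAct f l u) = letterAct f l (shift f k u) := by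
  rcases l with i | i
  · simp [shift_apply, letterAct, substS_algebraMap, mul_assoc]
  · have hX : algebraMap K[X] (RsInv f) X = algebraMap (MvPolynomial (Fin n) K[X]) (RsInv f)
        (MvPolynomial.C X) := by
      rw [IsScalarTower.algebraMap_apply K[X] (MvPolynomial (Fin n) K[X]) (RsInv f)]; rfl
    simp only [shift_apply, letterAct, LinearMap.add_apply, LinearMap.mulLeft_apply,
      Derivation.coeFn_coe, map_add, map_mul, Derivation.leibniz, partialRs_substS, fsLogDeriv, hX,
      substS_algebraMap, substS_invSelf, map_compRingHom_toRs, MvPolynomial.map_C,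
      partialRs_invSelf_pow, smul_eq_mul, coe_compRingHom_apply, X_comp, map_sub, map_natCast]
    ring

theorem shift_weylAct (k : ℕ) (D : WeylAlgebra K n) (u : RsInv f) :
    shift f k (weylAct f D u) = weylAct f D (shift f k u) := by
  obtain ⟨D, rfl⟩ := RingQuot.mkAlgHom_surjective K (WeylRel K n) D
  have hlift : ∀ D (v : RsInv f), weylAct f (RingQuot.mkAlgHom K (WeylRel K n) D) v =
      FreeAlgebra.lift K (letterAct f) D v := fun D v =>
    LinearMap.congr_fun (RingQuot.liftAlgHom_mkAlgHom_apply K _ _ _) v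
  rw [hlift, hlift]
  induction D using FreeAlgebra.induction generalizing u with
  | grade0 c =>
    rw [AlgHom.commutes]
    have := shift_smul k (C c) u
    simpa [Algebra.smul_def, algebraMap_C] using this
  | grade1 l => rw [FreeAlgebra.lift_ι_apply, shift_letterAct]
  | mul a b ha hb => rw [map_mul, Module.End.mul_apply, Module.End.mul_apply, ha, hb]
  | add a b ha hb => rw [map_add, LinearMap.add_apply, LinearMap.add_apply, map_add, ha, hb]

/-- The shift is only semilinear over `D_n[s]`: it carries `P(s)` to `P(s - k)`. -/
theorem exists_shift_weylSAct (k : ℕ) (P : (WeylAlgebra K n)[X]) :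
    ∃ Q : (WeylAlgebra K n)[X], ∀ u, shift f k (weylSAct f P u) = weylSAct f Q (shift f k u) := by
  induction P using Polynomial.induction_on with
  | C a => exact ⟨C a, fun u => by rw [weylSAct_C, shift_weylAct]⟩
  | add p q hp hq =>
    obtain ⟨p', hp'⟩ := hp
    obtain ⟨q', hq'⟩ := hq
    exact ⟨p' + q', fun u => by
      rw [map_add, map_add, LinearMap.add_apply, LinearMap.add_apply, map_add, hp', hq']⟩
  | monomial m a h =>
    obtain ⟨Q, hQ⟩ := h
    refine ⟨Q * WeylAlgebra.ofS K n (X - C (k : K)), fun u => ?_⟩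
    rw [pow_succ, ← mul_assoc, map_mul _ _ X, Module.End.mul_apply, hQ, map_mul _ Q,
      Module.End.mul_apply, weylSAct_X, shift_smul, weylSAct_ofS, X_comp]

theorem exists_solvesBernstein [CharZero K] (f : MvPolynomial (Fin n) K) :
    ∃ b : K[X], b ≠ 0 ∧ SolvesBernstein f b := by
  obtain ⟨k, a, ha, P, hP⟩ := exists_pow_mem_torsionClosure f
  obtain ⟨Q, hQ⟩ := exists_shift_weylSAct (f := f) k P
  refine ⟨a.comp (X - C (k : K)), ?_, Q, ?_⟩
  · rw [Ne, Polynomial.comp_eq_zero_iff]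
    rintro (h | ⟨-, h⟩)
    · exact ha h
    · have := congrArg natDegree h
      rw [natDegree_X_sub_C, natDegree_C] at this
      exact one_ne_zero this
  -- The shift sends `f^k` to `1` and `f^(k+1)` to `f`, so `a(s) f^k = P f^(k+1)` becomes `a(s - k)
  -- = Q f` in the module.
  · have h := congrArg (shift f k) hP
    rw [shift_smul, hQ, shift_apply, shift_apply, map_pow, map_pow, substS_toRs, ← mul_pow,
      algebraMap_toRs_mul_invSelf, one_pow, pow_succ', mul_assoc, ← mul_pow,
      algebraMap_toRs_mul_invSelf, one_pow] at h
    change weylSAct f (Q * polyInWeylS f) (1 : RsInv f) =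
      weylSAct f (WeylAlgebra.ofS K n _) (1 : RsInv f)
    rw [map_mul, Module.End.mul_apply, weylSAct_polyInWeylS, weylSAct_ofS, h]

end Shift

end

/-! ### The Bernstein-Sato polynomial as generator of the intersection with `K[s]` -/

noncomputable section

section BernsteinSato

variable {K : Type*} [Field K] {n : ℕ} {f : MvPolynomial (Fin n) K}

theorem range_ofS_le_center :
    (WeylAlgebra.ofS K n).range ≤ Subalgebra.center K (WeylAlgebra K n)[X] := by
  rintro _ ⟨p, rfl⟩
  refine Subalgebra.mem_center_iff.2 fun r => ?_
  change r * WeylAlgebra.ofS K n p = WeylAlgebra.ofS K n p * r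
  induction p using Polynomial.induction_on' with
  | add p q hp hq => rw [map_add, mul_add, add_mul, hp, hq]
  | monomial m c =>
    have : WeylAlgebra.ofS K n (monomial m c) = algebraMap K _ c * X ^ m := by
      simp [WeylAlgebra.ofS, C_mul_X_pow_eq_monomial, Polynomial.algebraMap_apply]
    rw [this, ← mul_assoc, ← Algebra.commutes, mul_assoc, mul_assoc, X_pow_mul]

/-- The equation `P f · f^s = b · f^s` says precisely that `b - P f` annihilates `f^s`. -/
theorem mem_comap_annFs_sup_span (b : K[X]) :
    b ∈ (annFs f ⊔ Ideal.span {polyInWeylS f}).comap (WeylAlgebra.ofS K n) ↔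
      SolvesBernstein f b := by
  rw [Ideal.mem_comap, Submodule.mem_sup]
  constructor
  · rintro ⟨Q, hQ, y, hy, h⟩
    obtain ⟨P, rfl⟩ := Ideal.mem_span_singleton'.1 hy
    refine ⟨P, ?_⟩
    rw [← h, add_smul, (mem_annFs f Q).1 hQ, zero_add]
  · rintro ⟨P, hP⟩
    refine ⟨WeylAlgebra.ofS K n b - P * polyInWeylS f, ?_, _,
      Ideal.mul_mem_left _ P (Ideal.mem_span_singleton_self _), sub_add_cancel _ _⟩
    rw [mem_annFs, sub_smul, hP, sub_self]

theorem comap_annFs_sup_span_ne_bot [CharZero K] (f : MvPolynomial (Fin n) K) :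
    (annFs f ⊔ Ideal.span {polyInWeylS f}).comap (WeylAlgebra.ofS K n) ≠ ⊥ := by
  obtain ⟨b, hb, h⟩ := exists_solvesBernstein f
  exact fun hbot => hb (by simpa [hbot] using (mem_comap_annFs_sup_span b).2 h)

theorem IsBernsteinSato.span_eq {b : K[X]} (hb : IsBernsteinSato f b) :
    (annFs f ⊔ Ideal.span {polyInWeylS f}).comap (WeylAlgebra.ofS K n) = Ideal.span {b} := by
  set J := (annFs f ⊔ Ideal.span {polyInWeylS f}).comap (WeylAlgebra.ofS K n) with hJ
  have hbJ : b ∈ J := (mem_comap_annFs_sup_span b).2 hb.2.1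
  refine le_antisymm (fun c hc => ?_) ((Ideal.span_singleton_le_iff_mem _).2 hbJ)
  rw [Ideal.mem_span_singleton, ← Polynomial.modByMonic_eq_zero_iff_dvd hb.1]
  by_contra hr
  have hrJ : c %ₘ b ∈ J := by
    rw [Polynomial.modByMonic_eq_sub_mul_div]
    exact J.sub_mem hc (J.mul_mem_right _ hbJ)
  -- A nonzero remainder, made monic, would be a solution of smaller degree than `b`.
  have h1 := hb.2.2 (c %ₘ b * C (c %ₘ b).leadingCoeff⁻¹) (monic_mul_leadingCoeff_inv hr)
    ((mem_comap_annFs_sup_span _).1 (J.mul_mem_right _ hrJ))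
  rw [natDegree_mul_leadingCoeff_inv _ hr] at h1
  have h2 := degree_modByMonic_lt c hb.1
  exact absurd (natDegree_lt_natDegree hr h2) (not_lt.2 h1)

theorem existsUnique_isBernsteinSato [CharZero K] (f : MvPolynomial (Fin n) K) :
    ∃! b : K[X], IsBernsteinSato f b := by
  classical
  have hex : ∃ m, ∃ b : K[X], b.Monic ∧ SolvesBernstein f b ∧ b.natDegree = m := by
    obtain ⟨b, hb, h⟩ := exists_solvesBernstein f
    exact ⟨_, b * C b.leadingCoeff⁻¹, monic_mul_leadingCoeff_inv hb,
      (mem_comap_annFs_sup_span _).1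
        (Ideal.mul_mem_right _ _ ((mem_comap_annFs_sup_span b).2 h)), rfl⟩
  obtain ⟨b, hb, hs, hdeg⟩ := Nat.find_spec hex
  have hB : IsBernsteinSato f b :=
    ⟨hb, hs, fun c hc h => hdeg.trans_le (Nat.find_min' hex ⟨c, hc, h, rfl⟩)⟩
  refine ⟨b, hB, fun c hc => ?_⟩
  have := hc.span_eq.symm.trans hB.span_eq
  exact eq_of_monic_of_associated hc.1 hb (Ideal.span_singleton_eq_span_singleton.1 this)

end BernsteinSato

end

theorem theorem2p1 {K : Type*} [Field K] [CharZero K] [DecidableEq K] :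
    -- the general statement: `R` is a `K`-algebra whose center contains `K[s]` (via `φ`),
    -- `I` is a left ideal, and `I ∩ K[s]` is `I.comap φ`
    (∀ {R : Type*} [Ring R] [Algebra K R] (φ : K[X] →ₐ[K] R),
      Function.Injective φ → φ.range ≤ Subalgebra.center K R →
      ∀ (q : K[X]) (I : Ideal R), I.comap φ ≠ ⊥ →
        (I ⊔ Ideal.span {φ q}).comap φ = I.comap φ ⊔ Ideal.span {q} ∧
        Ideal.comap φ (I.colon {φ q}) = (I.comap φ).colon {q} ∧
        (saturation I (φ q)).comap φ = saturation (I.comap φ) q) ∧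
    -- the case of `ann(f^s) + ⟨f⟩` in `D_n[s]`
    (∀ (n : ℕ) (f : MvPolynomial (Fin n) K), f ≠ 0 →
      (∃! b : K[X], IsBernsteinSato f b) ∧
      ∀ b : K[X], IsBernsteinSato f b → ∀ q : K[X],
        ((annFs f ⊔ Ideal.span {polyInWeylS f, WeylAlgebra.ofS K n q}).comap
            (WeylAlgebra.ofS K n) = Ideal.span {b, q} ∧
          Ideal.span {b, q} = Ideal.span {EuclideanDomain.gcd b q}) ∧
        (Ideal.comap (WeylAlgebra.ofS K n)
            ((annFs f ⊔ Ideal.span {polyInWeylS f}).colon {WeylAlgebra.ofS K n q}) =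
            (Ideal.span {b}).colon {q} ∧
          (Ideal.span {b}).colon {q} = Ideal.span {b / EuclideanDomain.gcd b q}) ∧
        (saturation (annFs f ⊔ Ideal.span {polyInWeylS f}) (WeylAlgebra.ofS K n q)).comap
            (WeylAlgebra.ofS K n) = saturation (Ideal.span {b}) q) := by
  refine ⟨?_, ?_⟩
  · intro R _ _ φ _ hφ q I hI
    exact ⟨comap_sup_span_singleton hφ q I hI, comap_colon_singleton q I,
      comap_saturation hφ q I⟩
  · intro n f _
    refine ⟨existsUnique_isBernsteinSato f, fun b hb q => ⟨⟨?_, span_pair_eq_span_gcd b q⟩,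
      ⟨?_, colon_span_singleton hb.1.ne_zero q⟩, ?_⟩⟩
    -- Regrouping as `(ann(f^s) + ⟨f⟩) + ⟨q⟩` brings the ideal into the form treated in (A).
    · rw [Ideal.span_insert, ← sup_assoc,
        comap_sup_span_singleton range_ofS_le_center q _ (comap_annFs_sup_span_ne_bot f),
        hb.span_eq, Ideal.span_insert]
    · rw [comap_colon_singleton, hb.span_eq]
    · rw [comap_saturation range_ofS_le_center, hb.span_eq]
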